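/- Conventions. All trees are finite; $[n]=\{1,\dots,n\}$. A leaf is a vertex of degree $1$, a node is a vertex of degree greater than $2$, and a tree is essential if it has no vertex of degree $2$. The twig of a leaf $F$ is the path from $F$ to a node $N$ that contains no node other than $N$; an edge is internal if it lies on no twig. A weighted tree is a tree $T$ with a function $w:E(T)\to\mathbb R$; it is positive-weighted if all weights are positive, and internal-nonzero-weighted if all internal edges have nonzero weight. For a nonempty set $I$ of vertices, $D_I(T,w)$ is the sum of the weights of the edges of the minimal subtree containing $I$. A weighted tree with leaf set $[n]$ realizes a family of real numbers $\{D_I\}$, $I$ ranging over the $k$-subsets of $[n]$, if $D_I(T,w)=D_I$ for all $I$. The family is l-treelike (resp. p-l-treelike) if there are a weighted (resp. positive-weighted) tree $(T,w)$ and an inclusion of $[n]$ into its set of leaves (the tree may have further leaves) such that $D_I(T,w)=D_I$ for all $I$. A tree with leaf set $[n]$ is a pseudostar of kind $(n,k)$ if every edge divides $[n]$ into two sets at least one of which has at least $k$ elements. Weighted trees with leaf set $[n]$ are identified when there is a weight-preserving isomorphism between them that is the identity on $[n]$. A $k$-IO operation on a weighted tree with leaf set $[n]$ takes an edge of weight $y$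 that divides $[n]$ into two sets with fewer than $k$ elements each, contracts it, and adds $y/k$ to the weight of every twig; the weights of the other internal edges do not change. A $k$-OI operation is the inverse of a $k$-IO operation. Inserting an internal edge of weight $0$ is the inverse of contracting an internal edge of weight $0$ (all other weights unchanged). Theorem. Let $3\le k\le n-1$ and let $\{D_I\}$, $I$ ranging over the $k$-subsets of $[n]$, be an l-treelike family of real numbers. Then there is exactly one internal-nonzero-weighted essential pseudostar $\mathcal P$ of kind $(n,k)$ realizing the family. Every other weighted essential tree with leaf set $[n]$ realizing the family can be obtained from $\mathcal P$ by finitely many operations, each of which is a $k$-OI operation or the insertion of an internal edge of weight $0$. If the family is p-l-treelike, then $\mathcal P$ is positive-weighted, and every other positive-weighted essential tree with leaf set $[n]$ realizing the family can be obtained from $\mathcal P$ by finitely many $k$-OI operations. -/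

import Mathlib

/-- A finite tree with real edge weights. Only the values of `weight` on the edges of `graph`
are ever used. -/
structure WeightedTree where
  V : Type
  [fintypeV : Fintype V]
  graph : SimpleGraph V
  isTree : graph.IsTree
  weight : Sym2 V → ℝ

attribute [instance] WeightedTree.fintypeV

namespace WeightedTree

variable (T : WeightedTree)

open Classical in
/-- The degree of a vertex. -/
noncomputable def deg (v : T.V) : ℕ := T.graph.degree v

/-- Leaves are the vertices of degree one. -/
def IsLeaf (v : T.V) : Prop := T.deg v = 1

/-- Nodes are the vertices of degree greater than two. -/
def IsNode (v : T.V) : Prop := 2 < T.deg v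

/-- A tree is essential if it has no vertices of degree two. -/
def IsEssential : Prop := ∀ v : T.V, T.deg v ≠ 2

/-- The minimal subtree containing a nonempty set `S` of vertices: the intersection of all the
subtrees (connected subgraphs) that contain `S`. -/
def minimalSubtree (S : Set T.V) : T.graph.Subgraph :=
  sInf {H : T.graph.Subgraph | H.Connected ∧ S ⊆ H.verts}

open Classical in
/-- The multiweight `D_S` of the tree: the weight of the minimal subtree containing `S`. -/
noncomputable def multiweight (S : Set T.V) : ℝ :=
  ∑ e : Sym2 T.V with e ∈ (T.minimalSubtree S).edgeSet, T.weight e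

/-- `p` is the twig associated to the leaf `F`: the path from `F` to a node `N` that contains no
node apart from `N`. -/
def IsTwig {F N : T.V} (p : T.graph.Walk F N) : Prop :=
  T.IsLeaf F ∧ T.IsNode N ∧ p.IsPath ∧ ∀ v ∈ p.support, T.IsNode v → v = N

/-- `e` is an edge of the twig associated to the leaf `F`. -/
def IsTwigEdge (F : T.V) (e : Sym2 T.V) : Prop :=
  ∃ (N : T.V) (p : T.graph.Walk F N), T.IsTwig p ∧ e ∈ p.edges

open Classical in
/-- The weight of the twig associated to the leaf `F`. -/
noncomputable def twigWeight (F : T.V) : ℝ :=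
  ∑ e : Sym2 T.V with T.IsTwigEdge F e, T.weight e

/-- An edge is internal if it is not an edge of a twig. -/
def IsInternal (e : Sym2 T.V) : Prop :=
  e ∈ T.graph.edgeSet ∧ ∀ F : T.V, ¬ T.IsTwigEdge F e

/-- All the weights are positive. -/
def IsPositive : Prop := ∀ e ∈ T.graph.edgeSet, 0 < T.weight e

/-- The weights of the internal edges are nonzero. -/
def IsInternalNonzero : Prop := ∀ e : Sym2 T.V, T.IsInternal e → T.weight e ≠ 0

/-- `φ` exhibits (the underlying tree of) `T'` as the result of contracting the edge `{a, b}`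
of `T`: it is onto, it identifies `a` with `b` and nothing else, and the edges of `T'` are the
images of the edges of `T` whose ends are not identified. -/
structure IsContraction (T T' : WeightedTree) (a b : T.V) (φ : T.V → T'.V) : Prop where
  adj : T.graph.Adj a b
  surjective : Function.Surjective φ
  eq_iff : ∀ u v : T.V, φ u = φ v ↔ u = v ∨ (u = a ∧ v = b) ∨ (u = b ∧ v = a)
  adj_iff : ∀ x y : T'.V,
    T'.graph.Adj x y ↔ x ≠ y ∧ ∃ u v : T.V, T.graph.Adj u v ∧ φ u = x ∧ φ v = y

end WeightedTree

/-- A weighted tree `T` with `L(T) = [n]`: the leaves are labelled bijectively by `Fin n`. -/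
structure LeafTree (n : ℕ) extends WeightedTree where
  leaf : Fin n → V
  leaf_injective : Function.Injective leaf
  range_leaf : Set.range leaf = {v : V | toWeightedTree.IsLeaf v}

/-- The `k`-subsets of `[n]`. -/
abbrev KSubset (n k : ℕ) : Type := {I : Finset (Fin n) // I.card = k}

namespace LeafTree

variable {n : ℕ}

/-- Equality of weighted trees with leaf set `[n]`: a weight-preserving isomorphism that is the
identity on the leaves. -/
def Iso (T T' : LeafTree n) : Prop :=
  ∃ φ : T.graph ≃g T'.graph, (∀ i, φ (T.leaf i) = T'.leaf i) ∧
    ∀ u v : T.V, T.graph.Adj u v → T'.weight s(φ u, φ v) = T.weight s(u, v)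

/-- The tree realizes the family `D`, indexed by the `k`-subsets of `[n]`. -/
def Realizes {k : ℕ} (T : LeafTree n) (D : KSubset n k → ℝ) : Prop :=
  ∀ I : KSubset n k, T.multiweight (T.leaf '' (I.1 : Set (Fin n))) = D I

/-- The leaves in the component of `a` after removing the edge `{a, b}`; this edge divides `[n]`
into `T.side a b` and `T.side b a`. -/
def side (T : LeafTree n) (a b : T.V) : Set (Fin n) :=
  {i | (T.graph.deleteEdges {s(a, b)}).Reachable (T.leaf i) a}

/-- Pseudostars of kind `(n, k)`. -/
def IsPseudostar (T : LeafTree n) (k : ℕ) : Prop :=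
  ∀ a b : T.V, T.graph.Adj a b → k ≤ (T.side a b).ncard ∨ k ≤ (T.side b a).ncard

/-- `T'` is obtained from `T` by a `k`-IO operation: an edge of weight `y` dividing `[n]` into two
sets with fewer than `k` elements each is contracted, `y / k` is added to the weight of every
twig, and the weights of the other internal edges are kept. -/
def IsIO (k : ℕ) (T T' : LeafTree n) : Prop :=
  ∃ (a b : T.V) (φ : T.V → T'.V),
    WeightedTree.IsContraction T.toWeightedTree T'.toWeightedTree a b φ ∧
    (∀ i, φ (T.leaf i) = T'.leaf i) ∧
    (T.side a b).ncard < k ∧ (T.side b a).ncard < k ∧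
    (∀ i, T'.twigWeight (T'.leaf i) = T.twigWeight (T.leaf i) + T.weight s(a, b) / (k : ℝ)) ∧
    ∀ u v : T.V, T.IsInternal s(u, v) → s(u, v) ≠ s(a, b) →
      T'.weight s(φ u, φ v) = T.weight s(u, v)

/-- `T'` is obtained from `T` by a `k`-OI operation, the inverse of a `k`-IO operation. -/
def IsOI (k : ℕ) (T T' : LeafTree n) : Prop := IsIO k T' T

/-- `T'` is obtained from `T` by inserting an internal edge of weight `0`. -/
def IsZeroInsertion (T T' : LeafTree n) : Prop :=
  ∃ (a b : T'.V) (φ : T'.V → T.V),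
    WeightedTree.IsContraction T'.toWeightedTree T.toWeightedTree a b φ ∧
    (∀ i, φ (T'.leaf i) = T.leaf i) ∧
    T'.IsInternal s(a, b) ∧ T'.weight s(a, b) = 0 ∧
    ∀ u v : T'.V, T'.graph.Adj u v → s(u, v) ≠ s(a, b) →
      T.weight s(φ u, φ v) = T'.weight s(u, v)

/-- `P` is an internal-nonzero-weighted essential pseudostar of kind `(n, k)` realizing `D`. -/
structure IsRealizingPseudostar {k : ℕ} (P : LeafTree n) (D : KSubset n k → ℝ) : Prop where
  internalNonzero : P.IsInternalNonzero
  essential : P.IsEssential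
  pseudostar : P.IsPseudostar k
  realizes : P.Realizes D

end LeafTree

/-- The family is given by the `k`-weights of `n` of the leaves of the weighted tree `T`, which
may have further leaves. -/
def IsFamilyOfLeaves {n k : ℕ} (T : WeightedTree) (D : KSubset n k → ℝ) : Prop :=
  ∃ f : Fin n → T.V, Function.Injective f ∧ (∀ i, T.IsLeaf (f i)) ∧
    ∀ I : KSubset n k, T.multiweight (f '' (I.1 : Set (Fin n))) = D I

/-- l-treelike families. -/
def IsLTreelike {n k : ℕ} (D : KSubset n k → ℝ) : Prop :=
  ∃ T : WeightedTree, IsFamilyOfLeaves T D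

/-- p-l-treelike families. -/
def IsPLTreelike {n k : ℕ} (D : KSubset n k → ℝ) : Prop :=
  ∃ T : WeightedTree, T.IsPositive ∧ IsFamilyOfLeaves T D

/-!
A tree enters its multiweights only through the splits of its leaf set: an edge `{a, b}` contributes
its weight to `D_I` exactly when `I` meets both `T.side a b` and `T.side b a`, the leaves on either
side of the edge. These sides come from the vertex sets `SimpleGraph.edgeComp`, and two edges of a
tree are compatible: one of the four intersections of their sides is empty.

*Existence and operations.* Contracting an edge removes one split and keeps the others
(`WeightedTree.IsContraction.multiweight_eq`). By induction on the number of vertices, the leaves of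
any tree that carry the family span an essential tree (`WeightedTree.exists_leafTree`). In an
essential tree the edges with fewer than `k` leaves on either side, and then the internal edges of
weight `0`, can be contracted one after another without changing the `k`-weights
(`LeafTree.exists_isRealizingPseudostar`). An edge of the first sort is counted in the weight of
every `k`-set, and so are exactly `k` twigs, so that spreading its weight evenly over the twigs
compensates for its loss.

*Uniqueness.* Let `{a, b}` be an internal edge of the pseudostar, with at least `k` leaves on the
side of `b`. Choose leaves `i, j` on the side of `a` whose path passes through `a`, leaves `l, m` on
the side of `b` whose path passes through `b`, and `k - 2 ≥ 1` further leaves `R` on the side of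
`b`. Then `{a, b}` is the only edge that separates `i, j` from `l, m`, and
`D_{ilR} + D_{jmR} - D_{ijR} - D_{lmR}` is its weight
(`LeafTree.pairSum_sub_pairSum`), while `D_{ilR} + D_{jmR} = D_{imR} + D_{jlR}`. As the weight is
not zero, every tree with the same `k`-weights must have an edge that separates `i, j` from `l, m`
(`LeafTree.separates_of_spans`). By compatibility the edges found for all these quartets combine to
one edge with the same split as `{a, b}`. Hence two pseudostars of the kind sought have the same
splits, and are isomorphic as trees (`LeafTree.exists_graphIso`): a vertex is the same as a
consistent orientation of all the splits. The quartet formula shows that the weights of their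
internal edges agree; the differences of the twig weights then have sum zero over every `k`-set,
and vanish because `0 < k < n`.

Given any essential tree realizing the family, the pseudostar to which it contracts is thus
isomorphic to the one fixed beforehand, and only the first operation has to be transported along the
isomorphism.
-/

/-! ### Components of a tree minus an edge -/

namespace SimpleGraph

variable {V : Type*} {G : SimpleGraph V} {a b c d u v x y : V}

/-- The vertices in the component of `a` after removing the edge `{a, b}`. In a tree, the edge
`{a, b}` divides the vertices into `G.edgeComp a b` and `G.edgeComp b a`. -/
def edgeComp (G : SimpleGraph V) (a b : V) : Set V :=
  {v | (G.deleteEdges {s(a, b)}).Reachable v a}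

lemma left_mem_edgeComp (G : SimpleGraph V) (a b : V) : a ∈ G.edgeComp a b :=
  Reachable.refl a

lemma mem_edgeComp_congr (h : G.Adj u v) (hne : s(u, v) ≠ s(a, b)) :
    u ∈ G.edgeComp a b ↔ v ∈ G.edgeComp a b := by
  have huv : (G.deleteEdges {s(a, b)}).Adj u v := by
    rw [deleteEdges_adj]; exact ⟨h, by simpa using hne⟩
  exact ⟨fun hu => huv.symm.reachable.trans hu, fun hv => huv.reachable.trans hv⟩

/-- A set that contains `a` and that is left by no edge apart from `{a, b}` contains the component
of `a`. -/
lemma edgeComp_subset {S : Set V} (ha : a ∈ S)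
    (hS : ∀ u v, G.Adj u v → s(u, v) ≠ s(a, b) → u ∈ S → v ∈ S) : G.edgeComp a b ⊆ S := by
  intro v hv
  obtain ⟨p⟩ := Reachable.symm hv
  by_contra hvS
  obtain ⟨d, -, h1, h2⟩ := p.exists_boundary_dart S ha hvS
  have h := d.adj
  rw [deleteEdges_adj] at h
  exact h2 (hS _ _ h.1 (by simpa using h.2) h1)

lemma exists_adj_of_connected (hG : G.Connected) {S : Set V} (hx : x ∈ S) (hy : y ∉ S) :
    ∃ u v, G.Adj u v ∧ u ∈ S ∧ v ∉ S := by
  obtain ⟨p⟩ := hG.preconnected x y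
  obtain ⟨d, -, h1, h2⟩ := p.exists_boundary_dart S hx hy
  exact ⟨d.fst, d.snd, d.adj, h1, h2⟩

lemma eq_univ_of_connected (hG : G.Connected) {S : Set V} (hx : x ∈ S)
    (hS : ∀ u v, G.Adj u v → u ∈ S → v ∈ S) (y : V) : y ∈ S := by
  by_contra hy
  obtain ⟨u, v, h, hu, hv⟩ := exists_adj_of_connected hG hx hy
  exact hv (hS u v h hu)

lemma edgeComp_subset_of_mem (hx : x ∈ G.edgeComp a b)
    (hb : b ∉ G.edgeComp x v) : G.edgeComp x v ⊆ G.edgeComp a b := by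
  have : G.edgeComp x v ⊆ G.edgeComp a b ∪ (G.edgeComp x v)ᶜ := by
    refine edgeComp_subset (Or.inl hx) ?_
    rintro y z hyz hne hy
    by_cases hz : z ∈ G.edgeComp x v
    · have hy' := (mem_edgeComp_congr hyz hne).2 hz
      refine Or.inl ((mem_edgeComp_congr hyz ?_).1 (hy.resolve_right (by simpa using hy')))
      intro he
      rcases Sym2.eq_iff.1 he with ⟨rfl, rfl⟩ | ⟨rfl, rfl⟩
      · exact hb hz
      · exact hb hy'
    · exact Or.inr hz
  intro y hy
  exact (this hy).resolve_right (by simpa using hy)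

/-- If `v` and `a` lie on the same side of the edge `{a, b}`, then a branch `G.edgeComp x v` at `v`
lies on that side too, unless it contains `b`. -/
lemma branch_subset (h : G.Adj x v) (hab : G.Adj a b) (hv : v ∈ G.edgeComp a b)
    (hb : b ∉ G.edgeComp x v) : G.edgeComp x v ⊆ G.edgeComp a b := by
  refine edgeComp_subset_of_mem ?_ hb
  by_cases hne : s(x, v) = s(a, b)
  · rcases Sym2.eq_iff.1 hne with ⟨rfl, rfl⟩ | ⟨rfl, rfl⟩
    · exact left_mem_edgeComp _ _ _
    · exact absurd (left_mem_edgeComp _ _ _) hb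
  · exact (mem_edgeComp_congr h hne).2 hv

/-- The side of `a` is a connected subgraph. -/
lemma connected_induce_edgeComp :
    ((⊤ : G.Subgraph).induce (G.edgeComp a b)).Connected := by
  have h : ((G.deleteEdges {s(a, b)}).connectedComponentMk a).supp = G.edgeComp a b := by
    ext v
    rw [ConnectedComponent.mem_supp_iff, ConnectedComponent.eq]; rfl
  have h2 := ((G.deleteEdges {s(a, b)}).connectedComponentMk a).connected_toSimpleGraph
  rw [← connected_induce_iff, ← h]
  exact h2.mono (fun x y hxy => (deleteEdges_le _ : G.deleteEdges {s(a, b)} ≤ G) hxy)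

namespace IsTree

variable (hG : G.IsTree)
include hG

lemma right_notMem_edgeComp (h : G.Adj a b) : b ∉ G.edgeComp a b := by
  intro hb
  have := isAcyclic_iff_forall_adj_isBridge.1 hG.isAcyclic h
  rw [isBridge_iff] at this
  exact this hb.symm

/-- A component of a tree minus an edge is determined by the edges that leave it. -/
lemma edgeComp_eq (h : G.Adj a b) {S : Set V} (ha : a ∈ S) (hb : b ∉ S)
    (hS : ∀ u v, G.Adj u v → s(u, v) ≠ s(a, b) → u ∈ S → v ∈ S) : G.edgeComp a b = S := by
  refine (edgeComp_subset ha hS).antisymm fun v hv => ?_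
  have key : v ∈ {v | v ∈ S → v ∈ G.edgeComp a b} := by
    refine eq_univ_of_connected (x := a) (S := {v | v ∈ S → v ∈ G.edgeComp a b}) hG.connected
      (fun _ => left_mem_edgeComp G a b) ?_ v
    intro u w huw hu hw
    by_cases hne : s(u, w) = s(a, b)
    · rcases Sym2.eq_iff.1 hne with ⟨rfl, rfl⟩ | ⟨rfl, rfl⟩
      · exact absurd hw hb
      · exact left_mem_edgeComp _ _ _
    · exact (mem_edgeComp_congr huw hne).1
        (hu (hS w u huw.symm (by rwa [Sym2.eq_swap]) hw))
  exact key hv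

lemma edgeComp_swap (h : G.Adj a b) : G.edgeComp b a = (G.edgeComp a b)ᶜ := by
  refine edgeComp_eq hG h.symm (hG.right_notMem_edgeComp h)
    (by simpa using left_mem_edgeComp G a b) ?_
  intro u v huv hne hu hv
  exact hu ((mem_edgeComp_congr huv (by rwa [Sym2.eq_swap (a := a)])).2 hv)

lemma mem_edgeComp_swap (h : G.Adj a b) : v ∈ G.edgeComp b a ↔ v ∉ G.edgeComp a b := by
  rw [hG.edgeComp_swap h]; rfl

lemma branch_disjoint (hx : G.Adj x v) (hy : G.Adj y v) (hne : x ≠ y)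
    (hu : u ∈ G.edgeComp x v) : u ∉ G.edgeComp y v := by
  have hxy : s(y, v) ≠ s(x, v) := fun h => hne (by
    rcases Sym2.eq_iff.1 h with ⟨h, -⟩ | ⟨h, h'⟩
    · exact h.symm
    · rw [h, h'])
  have hy' : y ∉ G.edgeComp x v := by
    rw [mem_edgeComp_congr hy hxy]; exact hG.right_notMem_edgeComp hx
  rw [← hG.mem_edgeComp_swap hy]
  exact branch_subset hx hy.symm (left_mem_edgeComp _ _ _) hy' hu

/-- Every vertex other than `v` lies in one of the branches at `v`. -/
lemma exists_branch (hne : u ≠ v) : ∃ x, G.Adj x v ∧ u ∈ G.edgeComp x v := by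
  have : u ∈ {u | u = v ∨ ∃ x, G.Adj x v ∧ u ∈ G.edgeComp x v} := by
    refine eq_univ_of_connected hG.connected (x := v) (Or.inl rfl) ?_ u
    rintro y z hyz (rfl | ⟨x, hx, hy⟩)
    · exact Or.inr ⟨z, hyz.symm, left_mem_edgeComp _ _ _⟩
    · by_cases he : s(y, z) = s(x, v)
      · rcases Sym2.eq_iff.1 he with ⟨rfl, rfl⟩ | ⟨rfl, rfl⟩
        · exact Or.inl rfl
        · exact Or.inr ⟨z, hx, left_mem_edgeComp _ _ _⟩
      · exact Or.inr ⟨x, hx, (mem_edgeComp_congr hyz he).1 hy⟩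
  exact this.resolve_left hne

/-- Two distinct vertices are separated by an edge. -/
lemma exists_edgeComp_of_ne (hne : u ≠ v) :
    ∃ a b, G.Adj a b ∧ u ∈ G.edgeComp a b ∧ v ∈ G.edgeComp b a := by
  obtain ⟨x, hx, hu⟩ := hG.exists_branch hne
  exact ⟨x, v, hx, hu, left_mem_edgeComp _ _ _⟩

/-- The edge that separates two adjacent vertices is the one that joins them. -/
lemma eq_of_adj_of_mem (h : G.Adj u v) (hab : G.Adj a b) (hu : u ∈ G.edgeComp a b)
    (hv : v ∈ G.edgeComp b a) : u = a ∧ v = b := by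
  rw [hG.mem_edgeComp_swap hab] at hv
  by_cases hne : s(u, v) = s(a, b)
  · rcases Sym2.eq_iff.1 hne with h | ⟨rfl, rfl⟩
    · exact h
    · exact absurd (left_mem_edgeComp _ _ _) hv
  · exact absurd ((mem_edgeComp_congr h hne).1 hu) hv

/-- Compatibility of two edges: one of the four intersections of their sides is empty. -/
lemma edgeComp_compat (hab : G.Adj a b) (hcd : G.Adj c d) :
    G.edgeComp c d ⊆ G.edgeComp a b ∨ G.edgeComp d c ⊆ G.edgeComp a b ∨
      G.edgeComp c d ⊆ G.edgeComp b a ∨ G.edgeComp d c ⊆ G.edgeComp b a := by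
  by_cases hc : c ∈ G.edgeComp a b
  · by_cases hb : b ∈ G.edgeComp c d
    · by_cases hd : d ∈ G.edgeComp a b
      · refine Or.inr (Or.inl (edgeComp_subset_of_mem hd ?_))
        rwa [hG.mem_edgeComp_swap hcd, not_not]
      · rw [← hG.mem_edgeComp_swap hab] at hd
        obtain ⟨rfl, rfl⟩ := hG.eq_of_adj_of_mem hcd hab hc hd
        exact Or.inl subset_rfl
    · exact Or.inl (edgeComp_subset_of_mem hc hb)
  · rw [← hG.mem_edgeComp_swap hab] at hc
    by_cases hb : a ∈ G.edgeComp c d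
    · by_cases hd : d ∈ G.edgeComp b a
      · refine Or.inr (Or.inr (Or.inr (edgeComp_subset_of_mem hd ?_)))
        rwa [hG.mem_edgeComp_swap hcd, not_not]
      · rw [← hG.mem_edgeComp_swap hab.symm] at hd
        obtain ⟨rfl, rfl⟩ := hG.eq_of_adj_of_mem hcd hab.symm hc hd
        exact Or.inr (Or.inr (Or.inl subset_rfl))
    · exact Or.inr (Or.inr (Or.inl (edgeComp_subset_of_mem hc hb)))

/-- Each side of an edge contains an end of the tree. -/
lemma exists_mem_edgeComp_forall_adj [Finite V] (h : G.Adj a b) :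
    ∃ p q, G.Adj p q ∧ p ∈ G.edgeComp a b ∧ ∀ r, G.Adj p r → r = q := by
  obtain ⟨⟨p, q⟩, ⟨hpq, hsub⟩, hmin⟩ := Set.exists_min_image
    {d : V × V | G.Adj d.1 d.2 ∧ G.edgeComp d.1 d.2 ⊆ G.edgeComp a b}
    (fun d => (G.edgeComp d.1 d.2).ncard) (Set.toFinite _) ⟨(a, b), h, subset_rfl⟩
  refine ⟨p, q, hpq, hsub (left_mem_edgeComp _ _ _), fun r hr => ?_⟩
  by_contra hrq
  have hss : G.edgeComp r p ⊂ G.edgeComp p q := by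
    refine ⟨fun u hu => ?_, fun hs => hG.right_notMem_edgeComp hr.symm
      (hs (left_mem_edgeComp _ _ _))⟩
    have := hG.branch_disjoint hr.symm hpq.symm hrq hu
    rwa [hG.mem_edgeComp_swap hpq, not_not] at this
  exact (hmin (r, p) ⟨hr.symm, hss.1.trans hsub⟩).not_gt (Set.ncard_lt_ncard hss)

end IsTree

end SimpleGraph

/-! ### Multiweights as sums over separating edges -/

namespace WeightedTree

variable (T : WeightedTree)

open SimpleGraph

/-- The edges of the minimal subtree containing `S` are those with a vertex of `S` on either
side. -/
lemma mem_edgeSet_minimalSubtree {S : Set T.V} {a b : T.V} :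
    s(a, b) ∈ (T.minimalSubtree S).edgeSet ↔ T.graph.Adj a b ∧
      (∃ v ∈ S, v ∈ T.graph.edgeComp a b) ∧ ∃ v ∈ S, v ∈ T.graph.edgeComp b a := by
  rw [Subgraph.mem_edgeSet, minimalSubtree, Subgraph.sInf_adj]
  constructor
  · rintro ⟨h, hab⟩
    have key : ∀ {a b : T.V}, T.graph.Adj a b →
        (∀ H : T.graph.Subgraph, H.Connected ∧ S ⊆ H.verts → H.Adj a b) →
        ∃ v ∈ S, v ∈ T.graph.edgeComp b a := by
      intro a b hab h
      by_contra hcon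
      push Not at hcon
      have := h ((⊤ : T.graph.Subgraph).induce (T.graph.edgeComp a b))
        ⟨connected_induce_edgeComp, fun v hv => by
          have := hcon v hv
          rwa [T.isTree.mem_edgeComp_swap hab, not_not] at this⟩
      exact T.isTree.right_notMem_edgeComp hab this.2.1
    exact ⟨hab, key hab.symm fun H hH => (h H hH).symm, key hab fun H hH => h H hH⟩
  · rintro ⟨hab, ⟨u, huS, hu⟩, v, hvS, hv⟩
    refine ⟨fun H ⟨hH, hS⟩ => ?_, hab⟩
    rw [T.isTree.mem_edgeComp_swap hab] at hv
    obtain ⟨p⟩ := hH.preconnected.coe ⟨u, hS huS⟩ ⟨v, hS hvS⟩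
    obtain ⟨d, -, h1, h2⟩ := p.exists_boundary_dart {x | x.1 ∈ T.graph.edgeComp a b} hu hv
    have hd : H.Adj d.fst.1 d.snd.1 := d.adj
    obtain ⟨h3, h4⟩ := T.isTree.eq_of_adj_of_mem hd.adj_sub hab h1
      ((T.isTree.mem_edgeComp_swap hab).2 h2)
    rwa [h3, h4] at hd

lemma edgeSet_minimalSubtree_subset {S : Set T.V} {e : Sym2 T.V}
    (h : e ∈ (T.minimalSubtree S).edgeSet) : e ∈ T.graph.edgeSet :=
  Subgraph.edgeSet_subset _ h

variable {T}

lemma IsLeaf.existsUnique_adj {v : T.V} (h : T.IsLeaf v) : ∃! w, T.graph.Adj v w := by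
  classical
  exact degree_eq_one_iff_existsUnique_adj.1 h

lemma isLeaf_of_forall_adj {v w : T.V} (h : T.graph.Adj v w) (hw : ∀ r, T.graph.Adj v r → r = w) :
    T.IsLeaf v := by
  classical
  exact degree_eq_one_iff_existsUnique_adj.2 ⟨w, h, hw⟩

lemma IsLeaf.edgeComp_eq {v w : T.V} (hv : T.IsLeaf v) (h : T.graph.Adj v w) :
    T.graph.edgeComp v w = {v} := by
  refine T.isTree.edgeComp_eq h rfl (fun h' => h.ne h'.symm) ?_
  rintro u x hux hne rfl
  exact absurd (congrArg (fun y => s(u, y)) (hv.existsUnique_adj.unique hux h)) hne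

lemma exists_leaf_mem_edgeComp {a b : T.V} (h : T.graph.Adj a b) :
    ∃ v ∈ T.graph.edgeComp a b, T.IsLeaf v := by
  obtain ⟨p, q, hpq, hp, hq⟩ := T.isTree.exists_mem_edgeComp_forall_adj h
  exact ⟨p, hp, isLeaf_of_forall_adj hpq hq⟩

lemma eq_or_eq_of_isLeaf {u v : T.V} (hu : T.IsLeaf u) (hv : T.IsLeaf v) (h : T.graph.Adj u v)
    (x : T.V) : x = u ∨ x = v := by
  refine eq_univ_of_connected (S := {x | x = u ∨ x = v}) T.isTree.connected (Or.inl rfl) ?_ x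
  rintro y z hyz (rfl | rfl)
  · exact Or.inr (hu.existsUnique_adj.unique hyz h)
  · exact Or.inl (hv.existsUnique_adj.unique hyz h.symm)

lemma deg_pos {u v : T.V} (h : u ≠ v) (w : T.V) : 0 < T.deg w := by
  classical
  have : Nontrivial T.V := ⟨u, v, h⟩
  exact T.isTree.connected.preconnected.degree_pos_of_nontrivial w

lemma IsNode.exists_branches {v : T.V} (h : T.IsNode v) : ∃ x y z, T.graph.Adj x v ∧
    T.graph.Adj y v ∧ T.graph.Adj z v ∧ x ≠ y ∧ x ≠ z ∧ y ≠ z := by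
  classical
  obtain ⟨x, y, z, hx, hy, hz, h1, h2, h3⟩ := Finset.two_lt_card_iff.1
    (show 2 < (T.graph.neighborFinset v).card from h)
  simp only [mem_neighborFinset] at hx hy hz
  exact ⟨x, y, z, hx.symm, hy.symm, hz.symm, h1, h2, h3⟩

lemma IsNode.exists_branch_ne {v : T.V} (h : T.IsNode v) (p q : T.V) :
    ∃ x, T.graph.Adj x v ∧ x ≠ p ∧ x ≠ q := by
  obtain ⟨x, y, z, hx, hy, hz, h1, h2, h3⟩ := h.exists_branches
  by_cases hxp : x = p ∨ x = q
  · by_cases hyp : y = p ∨ y = q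
    · refine ⟨z, hz, ?_, ?_⟩ <;> grind
    · exact ⟨y, hy, by tauto, by tauto⟩
  · exact ⟨x, hx, by tauto, by tauto⟩

/-- A node on one side of two edges has a branch on that side of both edges. -/
lemma IsNode.exists_leaf_mem_inter {v a b c d : T.V} (h : T.IsNode v) (hab : T.graph.Adj a b)
    (hcd : T.graph.Adj c d) (hva : v ∈ T.graph.edgeComp a b) (hvc : v ∈ T.graph.edgeComp c d) :
    ∃ u, T.IsLeaf u ∧ u ∈ T.graph.edgeComp a b ∧ u ∈ T.graph.edgeComp c d := by
  have hb : b ≠ v := fun hb => T.isTree.right_notMem_edgeComp hab (hb ▸ hva)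
  have hd : d ≠ v := fun hd => T.isTree.right_notMem_edgeComp hcd (hd ▸ hvc)
  obtain ⟨p, hp, hbp⟩ := T.isTree.exists_branch hb
  obtain ⟨q, hq, hdq⟩ := T.isTree.exists_branch hd
  obtain ⟨x, hx, hxp, hxq⟩ := h.exists_branch_ne p q
  obtain ⟨u, hu, hul⟩ := exists_leaf_mem_edgeComp hx
  exact ⟨u, hul, branch_subset hx hab hva (T.isTree.branch_disjoint hp hx hxp.symm hbp) hu,
    branch_subset hx hcd hvc (T.isTree.branch_disjoint hq hx hxq.symm hdq) hu⟩

end WeightedTree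

/-! ### Essential trees with labelled leaves -/

namespace LeafTree

open SimpleGraph WeightedTree

variable {n : ℕ} (T : LeafTree n)

lemma isLeaf_leaf (i : Fin n) : T.IsLeaf (T.leaf i) := by
  have : T.leaf i ∈ {v : T.V | T.IsLeaf v} := T.range_leaf ▸ Set.mem_range_self i
  exact this

variable {T} in
lemma exists_leaf_eq {v : T.V} (h : T.IsLeaf v) : ∃ i, T.leaf i = v := by
  have : v ∈ Set.range T.leaf := T.range_leaf.symm ▸ h
  exact this

/-- The vertex adjacent to the leaf `i`. -/
noncomputable def nbr (i : Fin n) : T.V := (T.isLeaf_leaf i).existsUnique_adj.choose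

lemma adj_nbr (i : Fin n) : T.graph.Adj (T.leaf i) (T.nbr i) :=
  (T.isLeaf_leaf i).existsUnique_adj.choose_spec.1

/-- The edge at the leaf `i`. -/
noncomputable def pend (i : Fin n) : Sym2 T.V := s(T.leaf i, T.nbr i)

variable {T}

lemma eq_nbr {i : Fin n} {v : T.V} (h : T.graph.Adj (T.leaf i) v) : v = T.nbr i :=
  (T.isLeaf_leaf i).existsUnique_adj.unique h (T.adj_nbr i)

lemma mem_side {a b : T.V} {i : Fin n} : i ∈ T.side a b ↔ T.leaf i ∈ T.graph.edgeComp a b :=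
  Iff.rfl

lemma side_swap {a b : T.V} (h : T.graph.Adj a b) : T.side b a = (T.side a b)ᶜ := by
  ext i
  rw [Set.mem_compl_iff, mem_side, mem_side, T.isTree.mem_edgeComp_swap h]

lemma mem_side_swap {a b : T.V} (h : T.graph.Adj a b) {i : Fin n} :
    i ∈ T.side b a ↔ i ∉ T.side a b := by
  rw [side_swap h]; rfl

lemma side_nonempty {a b : T.V} (h : T.graph.Adj a b) : (T.side a b).Nonempty := by
  obtain ⟨v, hv, hl⟩ := exists_leaf_mem_edgeComp h
  obtain ⟨i, rfl⟩ := exists_leaf_eq hl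
  exact ⟨i, hv⟩

lemma side_leaf_nbr (i : Fin n) : T.side (T.leaf i) (T.nbr i) = {i} := by
  ext j
  rw [mem_side, (T.isLeaf_leaf i).edgeComp_eq (T.adj_nbr i)]
  exact ⟨fun h => T.leaf_injective h, fun h => congrArg T.leaf h⟩

lemma side_eq_of_isLeaf {a b : T.V} (h : T.graph.Adj a b) (ha : T.IsLeaf a) :
    ∃ i, T.leaf i = a ∧ T.nbr i = b ∧ T.side a b = {i} := by
  obtain ⟨i, rfl⟩ := exists_leaf_eq ha
  obtain rfl := eq_nbr h
  exact ⟨i, rfl, rfl, side_leaf_nbr i⟩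

lemma isLeaf_or_isNode (hT : T.IsEssential) (hn : 3 ≤ n) (v : T.V) :
    T.IsLeaf v ∨ T.IsNode v := by
  have h01 : T.leaf ⟨0, by omega⟩ ≠ T.leaf ⟨1, by omega⟩ := fun h => by
    have := T.leaf_injective h
    simp at this
  have h1 := T.deg_pos h01 v
  have h2 := hT v
  unfold IsLeaf IsNode
  omega

lemma not_isLeaf_nbr (hn : 3 ≤ n) (i : Fin n) : ¬ T.IsLeaf (T.nbr i) := by
  intro h
  have key : ∀ v : T.V, v ∈ ({T.leaf i, T.nbr i} : Set T.V) :=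
    eq_or_eq_of_isLeaf (T.isLeaf_leaf i) h (T.adj_nbr i)
  have hcard : Fintype.card (Fin n) ≤ 2 := by
    rw [← Nat.card_eq_fintype_card, ← Set.ncard_univ,
      ← Set.ncard_image_of_injective _ T.leaf_injective]
    exact (Set.ncard_le_ncard (fun v _ => key v) (Set.toFinite _)).trans
      ((Set.ncard_insert_le _ _).trans (by rw [Set.ncard_singleton]))
  simp at hcard
  omega

lemma isNode_nbr (hT : T.IsEssential) (hn : 3 ≤ n) (i : Fin n) : T.IsNode (T.nbr i) :=
  (isLeaf_or_isNode hT hn _).resolve_left (not_isLeaf_nbr hn i)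

lemma pend_injective (hn : 3 ≤ n) : Function.Injective T.pend := by
  intro i j h
  rcases Sym2.eq_iff.1 h with ⟨h, -⟩ | ⟨-, h⟩
  · exact T.leaf_injective h
  · exact absurd (h ▸ T.isLeaf_leaf j) (not_isLeaf_nbr hn i)

/-- In an essential tree the twig of a leaf is the edge at that leaf. -/
lemma isTwigEdge_iff (hT : T.IsEssential) (hn : 3 ≤ n) (i : Fin n) (e : Sym2 T.V) :
    T.IsTwigEdge (T.leaf i) e ↔ e = T.pend i := by
  have hnode := isNode_nbr hT hn i
  have hleaf : ¬ T.IsNode (T.leaf i) := by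
    have := T.isLeaf_leaf i
    unfold IsLeaf at this
    unfold IsNode
    omega
  constructor
  · rintro ⟨N, p, ⟨-, hN, hp, huniq⟩, he⟩
    cases p with
    | nil => exact absurd hN hleaf
    | cons h q =>
      obtain rfl := eq_nbr h
      obtain rfl := huniq (T.nbr i) (by simp) hnode
      rw [Walk.cons_isPath_iff] at hp
      obtain rfl := Walk.eq_nil_iff_nil.2 (Walk.isPath_iff_nil.1 hp.1)
      simpa [pend] using he
  · rintro rfl
    refine ⟨T.nbr i, (T.adj_nbr i).toWalk, ⟨T.isLeaf_leaf i, hnode, ?_, ?_⟩, ?_⟩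
    · simp [(T.adj_nbr i).ne]
    · intro v hv hvN
      simp only [Walk.support_cons, Walk.support_nil, List.mem_cons, List.not_mem_nil,
        or_false] at hv
      rcases hv with rfl | rfl
      · exact absurd hvN hleaf
      · rfl
    · simp [pend]

lemma twigWeight_eq (hT : T.IsEssential) (hn : 3 ≤ n) (i : Fin n) :
    T.twigWeight (T.leaf i) = T.weight (T.pend i) := by
  classical
  unfold twigWeight
  simp_rw [isTwigEdge_iff hT hn i]
  rw [Finset.sum_filter, Finset.sum_ite_eq']
  simp

lemma isInternal_iff (hT : T.IsEssential) (hn : 3 ≤ n) {u v : T.V} :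
    T.IsInternal s(u, v) ↔ T.graph.Adj u v ∧ ¬ T.IsLeaf u ∧ ¬ T.IsLeaf v := by
  constructor
  · rintro ⟨h, hF⟩
    refine ⟨h, fun hu => ?_, fun hv => ?_⟩
    · obtain ⟨i, rfl, rfl, -⟩ := side_eq_of_isLeaf h hu
      exact hF _ ((isTwigEdge_iff hT hn i _).2 rfl)
    · obtain ⟨i, rfl, rfl, -⟩ := side_eq_of_isLeaf h.symm hv
      exact hF _ ((isTwigEdge_iff hT hn i _).2 Sym2.eq_swap)
  · rintro ⟨h, hu, hv⟩
    refine ⟨h, fun F hF => ?_⟩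
    obtain ⟨i, rfl⟩ : ∃ i, T.leaf i = F := exists_leaf_eq (by
      obtain ⟨N, p, hp, -⟩ := hF
      exact hp.1)
    rcases Sym2.eq_iff.1 ((isTwigEdge_iff hT hn i _).1 hF) with ⟨rfl, -⟩ | ⟨-, rfl⟩
    · exact hu (T.isLeaf_leaf i)
    · exact hv (T.isLeaf_leaf i)

/-- Two sides of edges of an essential tree that share a vertex share a leaf. -/
lemma exists_mem_side_inter (hT : T.IsEssential) (hn : 3 ≤ n) {v a b c d : T.V}
    (hab : T.graph.Adj a b) (hcd : T.graph.Adj c d) (hva : v ∈ T.graph.edgeComp a b)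
    (hvc : v ∈ T.graph.edgeComp c d) : ∃ i, i ∈ T.side a b ∧ i ∈ T.side c d := by
  rcases isLeaf_or_isNode hT hn v with hv | hv
  · obtain ⟨i, rfl⟩ := exists_leaf_eq hv
    exact ⟨i, hva, hvc⟩
  · obtain ⟨u, hu, h1, h2⟩ := hv.exists_leaf_mem_inter hab hcd hva hvc
    obtain ⟨i, rfl⟩ := exists_leaf_eq hu
    exact ⟨i, h1, h2⟩

lemma edgeComp_subset_of_side_subset (hT : T.IsEssential) (hn : 3 ≤ n) {a b c d : T.V}
    (hab : T.graph.Adj a b) (hcd : T.graph.Adj c d) (h : T.side a b ⊆ T.side c d) :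
    T.graph.edgeComp a b ⊆ T.graph.edgeComp c d := by
  intro v hv
  by_contra hvc
  rw [← T.isTree.mem_edgeComp_swap hcd] at hvc
  obtain ⟨i, hi, hi'⟩ := exists_mem_side_inter hT hn hab hcd.symm hv hvc
  exact (mem_side_swap hcd).1 hi' (h hi)

/-- An oriented edge of an essential tree is determined by the leaves on its side. -/
lemma eq_of_side_eq (hT : T.IsEssential) (hn : 3 ≤ n) {a b c d : T.V}
    (hab : T.graph.Adj a b) (hcd : T.graph.Adj c d) (h : T.side a b = T.side c d) :
    a = c ∧ b = d := by
  have h1 := edgeComp_subset_of_side_subset hT hn hab hcd h.subset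
  have h2 := edgeComp_subset_of_side_subset hT hn hab.symm hcd.symm
    (by rw [side_swap hab, side_swap hcd, h])
  exact T.isTree.eq_of_adj_of_mem hab hcd (h1 (left_mem_edgeComp _ _ _))
    (h2 (left_mem_edgeComp _ _ _))

lemma mem_edgeSet_minimalSubtree {I : Finset (Fin n)} {a b : T.V} (hab : T.graph.Adj a b) :
    s(a, b) ∈ (T.minimalSubtree (T.leaf '' (I : Set (Fin n)))).edgeSet ↔
      (∃ i ∈ I, i ∈ T.side a b) ∧ ∃ i ∈ I, i ∉ T.side a b := by
  rw [WeightedTree.mem_edgeSet_minimalSubtree]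
  simp only [hab, true_and, Set.exists_mem_image, Finset.mem_coe, ← mem_side, mem_side_swap hab]

lemma pend_mem_edgeSet_minimalSubtree {I : Finset (Fin n)} (hI : 2 ≤ I.card) (i : Fin n) :
    T.pend i ∈ (T.minimalSubtree (T.leaf '' (I : Set (Fin n)))).edgeSet ↔ i ∈ I := by
  rw [pend, mem_edgeSet_minimalSubtree (T.adj_nbr i), side_leaf_nbr]
  obtain ⟨j, hj, hji⟩ := Finset.exists_mem_ne (by omega : 1 < I.card) i
  constructor
  · rintro ⟨⟨l, hl, rfl⟩, -⟩
    exact hl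
  · exact fun hi => ⟨⟨i, hi, rfl⟩, j, hj, hji⟩

end LeafTree

/-! ### Contraction of an edge -/

namespace WeightedTree

open SimpleGraph

section EqIff

variable {T : WeightedTree} {W : Type*} {a b : T.V} {φ : T.V → W}

/-- The sides of an edge other than the contracted one are unions of fibres. -/
lemma mem_edgeComp_congr_of_eq (hab : T.graph.Adj a b)
    (hφ : ∀ u v : T.V, φ u = φ v ↔ u = v ∨ (u = a ∧ v = b) ∨ (u = b ∧ v = a)) {u v x y : T.V}
    (hne : s(u, v) ≠ s(a, b)) (hxy : φ x = φ y) :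
    x ∈ T.graph.edgeComp u v ↔ y ∈ T.graph.edgeComp u v := by
  rcases (hφ x y).1 hxy with rfl | ⟨rfl, rfl⟩ | ⟨rfl, rfl⟩
  · rfl
  · exact mem_edgeComp_congr hab hne.symm
  · exact (mem_edgeComp_congr hab hne.symm).symm

lemma injOn_map_of_eq_iff (hab : T.graph.Adj a b)
    (hφ : ∀ u v : T.V, φ u = φ v ↔ u = v ∨ (u = a ∧ v = b) ∨ (u = b ∧ v = a)) :
    Set.InjOn (Sym2.map φ) {e | e ∈ T.graph.edgeSet ∧ e ≠ s(a, b)} := by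
  rintro ⟨u, v⟩ ⟨huv, hne⟩ ⟨x, y⟩ ⟨hxy, -⟩ he
  simp only [Sym2.map_mk, mem_edgeSet, Sym2.mk] at huv hxy he
  have hne' : s(v, u) ≠ s(a, b) := by rw [Sym2.eq_swap]; exact hne
  have key : ∀ {x y : T.V}, T.graph.Adj x y → φ u = φ x → φ v = φ y → u = x ∧ v = y := by
    intro x y hxy h1 h2
    obtain ⟨h3, h4⟩ := T.isTree.eq_of_adj_of_mem hxy huv
      ((mem_edgeComp_congr_of_eq hab hφ hne h1).1 (left_mem_edgeComp _ _ _))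
      ((mem_edgeComp_congr_of_eq hab hφ hne' h2).1 (left_mem_edgeComp _ _ _))
    exact ⟨h3.symm, h4.symm⟩
  rcases Sym2.eq_iff.1 he with ⟨h1, h2⟩ | ⟨h1, h2⟩
  · obtain ⟨rfl, rfl⟩ := key hxy h1 h2
    rfl
  · obtain ⟨rfl, rfl⟩ := key (Adj.symm hxy) h1 h2
    exact Sym2.eq_swap

end EqIff

/-- Every edge of a tree can be contracted, and the weights of the other edges can be prescribed. -/
lemma exists_isContraction (T : WeightedTree) {a b : T.V} (hab : T.graph.Adj a b)
    (w : Sym2 T.V → ℝ) : ∃ (T' : WeightedTree) (φ : T.V → T'.V), IsContraction T T' a b φ ∧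
      (∀ e ∈ T.graph.edgeSet, e ≠ s(a, b) → T'.weight (e.map φ) = w e) ∧
      Fintype.card T'.V < Fintype.card T.V := by
  classical
  let W : Type := {v : T.V // v ≠ b}
  let φ : T.V → W := fun v => if h : v = b then ⟨a, hab.ne⟩ else ⟨v, h⟩
  have hφ : ∀ u v : T.V, φ u = φ v ↔ u = v ∨ (u = a ∧ v = b) ∨ (u = b ∧ v = a) := by
    intro u v
    have := hab.ne
    by_cases hu : u = b <;> by_cases hv : v = b <;> simp [φ, hu, hv] <;> grind
  have hsurj : Function.Surjective φ := fun x => ⟨x.1, by simp [φ, x.2]⟩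
  let G : SimpleGraph W :=
    { Adj := fun x y => x ≠ y ∧ ∃ u v : T.V, T.graph.Adj u v ∧ φ u = x ∧ φ v = y
      symm := ⟨fun x y ⟨h, u, v, huv, hu, hv⟩ => ⟨h.symm, v, u, huv.symm, hv, hu⟩⟩
      loopless := ⟨fun x h => h.1 rfl⟩ }
  have hconn : G.Connected := by
    have : Nonempty W := ⟨φ a⟩
    refine ⟨fun x y => ?_⟩
    obtain ⟨u, rfl⟩ := hsurj x
    obtain ⟨v, rfl⟩ := hsurj y
    refine eq_univ_of_connected (S := {v | G.Reachable (φ u) (φ v)}) T.isTree.connected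
      (x := u) (Reachable.refl _) ?_ v
    intro x y hxy hx
    by_cases h : φ x = φ y
    · simpa only [Set.mem_ofPred_eq, ← h] using hx
    · exact Reachable.trans hx (Adj.reachable ⟨h, x, y, hxy, rfl, rfl⟩)
  have hcard : Fintype.card W + 1 = Fintype.card T.V := by
    have h1 : Fintype.card W = Fintype.card T.V - 1 := Set.card_ne_eq b
    have h2 : 0 < Fintype.card T.V := Fintype.card_pos_iff.2 ⟨a⟩
    omega
  have hE : G.edgeSet ⊆ Sym2.map φ '' (T.graph.edgeSet \ {s(a, b)}) := by
    rintro ⟨x, y⟩ ⟨hne, u, v, huv, rfl, rfl⟩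
    refine ⟨s(u, v), ⟨huv, fun h => hne ?_⟩, rfl⟩
    rw [hφ]
    exact Or.inr (Sym2.eq_iff.1 h)
  have htree : G.IsTree := by
    rw [isTree_iff_connected_and_card]
    refine ⟨hconn, ?_⟩
    have h1 := hconn.card_vert_le_card_edgeSet_add_one
    have h2 := (isTree_iff_connected_and_card.1 T.isTree).2
    have h3 := (Set.ncard_le_ncard hE (Set.toFinite _)).trans (Set.ncard_image_le (Set.toFinite _))
    have h4 := Set.ncard_sdiff_singleton_add_one (s := T.graph.edgeSet) (a := s(a, b)) hab
      (Set.toFinite _)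
    rw [Nat.card_coe_set_eq, Nat.card_eq_fintype_card] at h1 h2
    rw [Nat.card_coe_set_eq, Nat.card_eq_fintype_card]
    omega
  let T' : WeightedTree :=
    { V := W
      graph := G
      isTree := htree
      weight := fun e' => if h : ∃ e, (e ∈ T.graph.edgeSet ∧ e ≠ s(a, b)) ∧ e.map φ = e' then
        w h.choose else 0 }
  refine ⟨T', φ, ⟨hab, hsurj, hφ, fun x y => Iff.rfl⟩, ?_, ?_⟩
  · intro e he hne
    have h : ∃ e₁, (e₁ ∈ T.graph.edgeSet ∧ e₁ ≠ s(a, b)) ∧ e₁.map φ = e.map φ :=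
      ⟨e, ⟨he, hne⟩, rfl⟩
    change dite _ _ _ = _
    rw [dif_pos h]
    exact congrArg w (injOn_map_of_eq_iff hab hφ h.choose_spec.1 ⟨he, hne⟩ h.choose_spec.2)
  · change Fintype.card W < _
    omega

namespace IsContraction

variable {T T' : WeightedTree} {a b : T.V} {φ : T.V → T'.V} (h : IsContraction T T' a b φ)
include h

lemma map_left_eq : φ a = φ b := (h.eq_iff a b).2 (Or.inr (Or.inl ⟨rfl, rfl⟩))

lemma eq_of_map_eq {u v : T.V} (hua : u ≠ a) (hub : u ≠ b) (he : φ u = φ v) : u = v := by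
  rcases (h.eq_iff u v).1 he with h | h | h
  · exact h
  · exact absurd h.1 hua
  · exact absurd h.1 hub

lemma map_adj {u v : T.V} (huv : T.graph.Adj u v) (hne : s(u, v) ≠ s(a, b)) :
    T'.graph.Adj (φ u) (φ v) := by
  refine (h.adj_iff _ _).2 ⟨fun he => ?_, u, v, huv, rfl, rfl⟩
  rcases (h.eq_iff u v).1 he with rfl | he
  · exact huv.ne rfl
  · exact hne (Sym2.eq_iff.2 he)

lemma exists_adj {x y : T'.V} (hxy : T'.graph.Adj x y) :
    ∃ u v, T.graph.Adj u v ∧ s(u, v) ≠ s(a, b) ∧ φ u = x ∧ φ v = y := by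
  obtain ⟨hne, u, v, huv, rfl, rfl⟩ := (h.adj_iff _ _).1 hxy
  exact ⟨u, v, huv, fun he => hne ((h.eq_iff _ _).2 (Or.inr (Sym2.eq_iff.1 he))), rfl, rfl⟩

lemma mem_edgeComp_iff {u v : T.V} (huv : T.graph.Adj u v) (hne : s(u, v) ≠ s(a, b)) (x : T.V) :
    φ x ∈ T'.graph.edgeComp (φ u) (φ v) ↔ x ∈ T.graph.edgeComp u v := by
  have hsat : ∀ {y : T.V}, φ y ∈ φ '' T.graph.edgeComp u v ↔ y ∈ T.graph.edgeComp u v :=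
    fun {y} => ⟨fun ⟨z, hz, hzy⟩ => (mem_edgeComp_congr_of_eq h.adj h.eq_iff hne hzy).1 hz,
      fun hy => ⟨y, hy, rfl⟩⟩
  rw [T'.isTree.edgeComp_eq (h.map_adj huv hne) (S := φ '' T.graph.edgeComp u v)
    (hsat.2 (left_mem_edgeComp _ _ _)) (fun hv => T.isTree.right_notMem_edgeComp huv (hsat.1 hv)),
    hsat]
  intro x y hxy hxy' hx
  obtain ⟨p, q, hpq, -, rfl, rfl⟩ := h.exists_adj hxy
  rw [hsat] at hx ⊢
  refine (mem_edgeComp_congr hpq fun he => hxy' ?_).1 hx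
  simpa using congrArg (Sym2.map φ) he

lemma mem_edgeSet_minimalSubtree_iff {S : Set T.V} {e : Sym2 T.V} (he : e ∈ T.graph.edgeSet)
    (hne : e ≠ s(a, b)) : e.map φ ∈ (T'.minimalSubtree (φ '' S)).edgeSet ↔
      e ∈ (T.minimalSubtree S).edgeSet := by
  induction e with
  | _ u v =>
    have huv : T.graph.Adj u v := he
    have hne' : s(v, u) ≠ s(a, b) := by rwa [Sym2.eq_swap]
    rw [Sym2.map_mk, mem_edgeSet_minimalSubtree, mem_edgeSet_minimalSubtree]
    simp only [h.map_adj huv hne, huv, true_and, Set.exists_mem_image,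
      h.mem_edgeComp_iff huv hne, h.mem_edgeComp_iff huv.symm hne']

open Classical in
/-- The multiweights after contracting an edge. -/
lemma multiweight_eq {w : Sym2 T.V → ℝ}
    (hw : ∀ e ∈ T.graph.edgeSet, e ≠ s(a, b) → T'.weight (e.map φ) = w e) (S : Set T.V) :
    T'.multiweight (φ '' S) =
      ∑ e : Sym2 T.V with e ∈ (T.minimalSubtree S).edgeSet, if e = s(a, b) then 0 else w e := by
  unfold multiweight
  rw [← Finset.sum_filter_of_ne (p := fun e => e ≠ s(a, b)) (by
    intro e _ h0 he
    exact h0 (if_pos he))]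
  symm
  refine Finset.sum_bij (fun e _ => e.map φ) ?_ ?_ ?_ ?_
  · intro e he
    simp only [Finset.mem_filter, Finset.mem_univ, true_and] at he ⊢
    exact (h.mem_edgeSet_minimalSubtree_iff (T.edgeSet_minimalSubtree_subset he.1) he.2).2 he.1
  · intro e he e' he' heq
    simp only [Finset.mem_filter, Finset.mem_univ, true_and] at he he'
    exact injOn_map_of_eq_iff h.adj h.eq_iff ⟨T.edgeSet_minimalSubtree_subset he.1, he.2⟩
      ⟨T.edgeSet_minimalSubtree_subset he'.1, he'.2⟩ heq
  · intro e' he'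
    simp only [Finset.mem_filter, Finset.mem_univ, true_and] at he'
    obtain ⟨x, y⟩ := e'
    obtain ⟨u, v, huv, hne, rfl, rfl⟩ := h.exists_adj (T'.edgeSet_minimalSubtree_subset he')
    refine ⟨s(u, v), ?_, rfl⟩
    simp only [Finset.mem_filter, Finset.mem_univ, true_and]
    exact ⟨(h.mem_edgeSet_minimalSubtree_iff huv hne).1 he', hne⟩
  · intro e he
    simp only [Finset.mem_filter, Finset.mem_univ, true_and] at he
    rw [if_neg he.2, hw e (T.edgeSet_minimalSubtree_subset he.1) he.2]

lemma deg_of_ne {v : T.V} (hva : v ≠ a) (hvb : v ≠ b) : T'.deg (φ v) = T.deg v := by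
  classical
  have hN : T'.graph.neighborFinset (φ v) = (T.graph.neighborFinset v).image φ := by
    ext y
    simp only [mem_neighborFinset, Finset.mem_image]
    constructor
    · intro hy
      obtain ⟨u, w, huw, -, hu, rfl⟩ := h.exists_adj hy
      obtain rfl := h.eq_of_map_eq hva hvb hu.symm
      exact ⟨w, huw, rfl⟩
    · rintro ⟨w, hw, rfl⟩
      exact h.map_adj hw fun he => by
        rcases Sym2.eq_iff.1 he with ⟨h, -⟩ | ⟨h, -⟩ <;> contradiction
  unfold deg
  rw [← card_neighborFinset_eq_degree, ← card_neighborFinset_eq_degree, hN,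
    Finset.card_image_of_injOn]
  intro x hx y hy hxy
  simp only [coe_neighborFinset, mem_neighborSet] at hx hy
  rcases (h.eq_iff x y).1 hxy with he | ⟨rfl, rfl⟩ | ⟨rfl, rfl⟩
  · exact he
  -- Otherwise `v` would form a triangle with `a` and `b`.
  all_goals
    exfalso
    have h1 : v ∈ T.graph.edgeComp x y :=
      (mem_edgeComp_congr hx (by grind)).2 (left_mem_edgeComp _ _ _)
    have h2 := (mem_edgeComp_congr (a := x) (b := y) hy (by grind)).1 h1
    exact T.isTree.right_notMem_edgeComp (by first | exact h.adj | exact h.adj.symm) h2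

lemma deg_add_two : T'.deg (φ a) + 2 = T.deg a + T.deg b := by
  classical
  have hab := h.adj
  have hN : T'.graph.neighborFinset (φ a) = ((T.graph.neighborFinset a).erase b ∪
      (T.graph.neighborFinset b).erase a).image φ := by
    ext y
    simp only [mem_neighborFinset, Finset.mem_image, Finset.mem_union, Finset.mem_erase]
    constructor
    · intro hy
      obtain ⟨u, w, huw, hne, hu, rfl⟩ := h.exists_adj hy
      refine ⟨w, ?_, rfl⟩
      rcases (h.eq_iff u a).1 hu with rfl | ⟨rfl, he⟩ | ⟨rfl, -⟩
      · exact Or.inl ⟨fun he => hne (by rw [he]), huw⟩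
      · exact absurd he hab.ne
      · exact Or.inr ⟨fun he => hne (by rw [he, Sym2.eq_swap]), huw⟩
    · rintro ⟨w, ⟨hwb, hw⟩ | ⟨hwa, hw⟩, rfl⟩
      · exact h.map_adj hw (by grind)
      · rw [h.map_left_eq]
        exact h.map_adj hw (by grind)
  have hdisj : Disjoint ((T.graph.neighborFinset a).erase b)
      ((T.graph.neighborFinset b).erase a) := by
    rw [Finset.disjoint_left]
    intro w hw hw'
    simp only [Finset.mem_erase, mem_neighborFinset] at hw hw'
    have h1 : w ∈ T.graph.edgeComp a b :=
      (mem_edgeComp_congr hw.2 (by grind)).1 (left_mem_edgeComp _ _ _)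
    exact T.isTree.right_notMem_edgeComp hab ((mem_edgeComp_congr hw'.2 (by grind)).2 h1)
  have hinj : Set.InjOn φ ↑((T.graph.neighborFinset a).erase b ∪
      (T.graph.neighborFinset b).erase a) := by
    intro x hx y hy hxy
    have hx' : x ≠ a ∧ x ≠ b := by
      simp only [Finset.coe_union, Finset.coe_erase, coe_neighborFinset, Set.mem_union,
        Set.mem_sdiff, mem_neighborSet, Set.mem_singleton_iff] at hx
      rcases hx with hx | hx
      · exact ⟨hx.1.ne', hx.2⟩
      · exact ⟨hx.2, hx.1.ne'⟩
    exact h.eq_of_map_eq hx'.1 hx'.2 hxy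
  have h1 := Finset.card_erase_add_one ((mem_neighborFinset T.graph a b).2 hab)
  have h2 := Finset.card_erase_add_one ((mem_neighborFinset T.graph b a).2 hab.symm)
  unfold deg
  rw [← card_neighborFinset_eq_degree, ← card_neighborFinset_eq_degree,
    ← card_neighborFinset_eq_degree, hN, Finset.card_image_of_injOn hinj,
    Finset.card_union_of_disjoint hdisj]
  omega

lemma isPositive {w : Sym2 T.V → ℝ}
    (hw : ∀ e ∈ T.graph.edgeSet, e ≠ s(a, b) → T'.weight (e.map φ) = w e)
    (hpos : ∀ e ∈ T.graph.edgeSet, 0 < w e) : T'.IsPositive := by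
  rintro ⟨x, y⟩ hxy
  obtain ⟨u, v, huv, hne, rfl, rfl⟩ := h.exists_adj hxy
  exact (hw s(u, v) huv hne).symm ▸ hpos _ huv

end IsContraction

end WeightedTree

/-! ### Reduction to essential trees -/

namespace WeightedTree

open SimpleGraph

/-- The multiweights of `n ≥ 3` leaves of a tree are those of an essential tree with these leaves
only: superfluous leaves and vertices of degree two are removed by contracting edges. -/
lemma exists_leafTree {n : ℕ} (hn : 3 ≤ n) (T : WeightedTree) (f : Fin n → T.V)
    (hf : Function.Injective f) (hleaf : ∀ i, T.IsLeaf (f i)) :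
    ∃ L : LeafTree n, L.IsEssential ∧ (∀ I : Finset (Fin n),
      L.multiweight (L.leaf '' (I : Set (Fin n))) = T.multiweight (f '' (I : Set (Fin n)))) ∧
      (T.IsPositive → L.IsPositive) := by
  classical
  induction hN : Fintype.card T.V using Nat.strong_induction_on generalizing T with
  | _ N ih =>
    subst hN
    -- The edge at a leaf that is not labelled separates no labels and can be dropped.
    by_cases h1 : ∃ v, T.IsLeaf v ∧ ∀ i, f i ≠ v
    · obtain ⟨v, hv, hfv⟩ := h1
      obtain ⟨x, hvx, -⟩ := hv.existsUnique_adj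
      have hfx : ∀ i, f i ≠ x := by
        rintro i hi
        have key : ∀ j, f j = x := fun j =>
          (eq_or_eq_of_isLeaf hv (hi ▸ hleaf i) hvx (f j)).resolve_left (hfv j)
        have := hf ((key ⟨0, by omega⟩).trans (key ⟨1, by omega⟩).symm)
        simp at this
      obtain ⟨T', φ, h, hw, hlt⟩ := T.exists_isContraction hvx T.weight
      obtain ⟨L, hL, hLD, hLpos⟩ := ih _ hlt T' (φ ∘ f)
        (fun i j hij => hf (h.eq_of_map_eq (hfv i) (hfx i) hij))
        (fun i => by
          unfold IsLeaf
          rw [Function.comp, h.deg_of_ne (hfv i) (hfx i)]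
          exact hleaf i) rfl
      refine ⟨L, hL, fun I => ?_, fun hpos => hLpos (h.isPositive hw hpos)⟩
      rw [hLD, Set.image_comp, h.multiweight_eq hw, multiweight]
      refine Finset.sum_congr rfl fun e he => if_neg ?_
      rintro rfl
      simp only [Finset.mem_filter, Finset.mem_univ, true_and,
        WeightedTree.mem_edgeSet_minimalSubtree, hv.edgeComp_eq hvx] at he
      obtain ⟨-, ⟨_, ⟨i, -, rfl⟩, hi⟩, -⟩ := he
      exact hfv i hi
    by_cases h2 : ∃ v, T.deg v = 2
    · obtain ⟨v, hv⟩ := h2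
      obtain ⟨x, y, hxy, hN⟩ := Finset.card_eq_two.1 (show (T.graph.neighborFinset v).card = 2
        from hv)
      have hadj : ∀ z, T.graph.Adj v z ↔ z = x ∨ z = y := fun z => by
        rw [← mem_neighborFinset, hN]; simp
      have hvx := (hadj x).2 (Or.inl rfl)
      have hvy := (hadj y).2 (Or.inr rfl)
      have hfv : ∀ i, f i ≠ v := fun i hi => by
        have := hleaf i
        unfold IsLeaf at this
        rw [hi] at this
        omega
      have hne : s(v, y) ≠ s(v, x) := by
        have := hvx.ne
        grind
      -- The two edges at `v` separate the same sets of leaves, so that the weight of the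
      -- contracted one can be moved to the other one.
      have hmem : ∀ I : Finset (Fin n),
          s(v, x) ∈ (T.minimalSubtree (f '' (I : Set (Fin n)))).edgeSet ↔
            s(v, y) ∈ (T.minimalSubtree (f '' (I : Set (Fin n)))).edgeSet := by
        intro I
        have key : ∀ i, f i ∈ T.graph.edgeComp y v ↔ f i ∉ T.graph.edgeComp x v := by
          intro i
          refine ⟨T.isTree.branch_disjoint hvy.symm hvx.symm hxy.symm, fun h => ?_⟩
          obtain ⟨z, hz, hiz⟩ := T.isTree.exists_branch (hfv i)
          rcases (hadj z).1 hz.symm with rfl | rfl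
          · exact absurd hiz h
          · exact hiz
        rw [WeightedTree.mem_edgeSet_minimalSubtree, WeightedTree.mem_edgeSet_minimalSubtree]
        simp only [hvx, hvy, true_and, Set.exists_mem_image, T.isTree.mem_edgeComp_swap hvx.symm,
          T.isTree.mem_edgeComp_swap hvy.symm, key, not_not]
        exact and_comm
      obtain ⟨T', φ, h, hw, hlt⟩ := T.exists_isContraction hvx
        (fun e => T.weight e + if e = s(v, y) then T.weight s(v, x) else 0)
      obtain ⟨L, hL, hLD, hLpos⟩ := ih _ hlt T' (φ ∘ f)
        (fun i j hij => by
          rcases (h.eq_iff _ _).1 hij with h | h | h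
          · exact hf h
          · exact absurd h.1 (hfv i)
          · exact absurd h.2 (hfv j))
        (fun i => by
          have hi := hleaf i
          unfold IsLeaf at hi ⊢
          rw [Function.comp]
          by_cases hix : f i = x
          · have := h.deg_add_two
            rw [h.map_left_eq] at this
            rw [hix] at hi ⊢
            omega
          · rw [h.deg_of_ne (hfv i) hix, hi]) rfl
      refine ⟨L, hL, fun I => ?_, fun hpos => hLpos (h.isPositive hw fun e he => ?_)⟩
      · rw [hLD, Set.image_comp, h.multiweight_eq hw, multiweight]
        have hsum : ∀ e : Sym2 T.V, (if e = s(v, x) then 0 else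
            T.weight e + if e = s(v, y) then T.weight s(v, x) else 0) = T.weight e +
              ((if e = s(v, y) then T.weight s(v, x) else 0) -
                if e = s(v, x) then T.weight s(v, x) else 0) := by
          intro e
          by_cases h1 : e = s(v, x)
          · subst h1
            simp [hne.symm]
          · simp [h1]
        simp_rw [hsum]
        rw [Finset.sum_add_distrib, Finset.sum_sub_distrib, Finset.sum_ite_eq',
          Finset.sum_ite_eq']
        simp [hmem]
      · have := hpos e he
        have := hpos s(v, x) hvx
        positivity
    · push Not at h1 h2
      refine ⟨{ toWeightedTree := T, leaf := f, leaf_injective := hf, range_leaf := ?_ }, h2,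
        fun I => rfl, id⟩
      ext v
      exact ⟨fun ⟨i, hi⟩ => hi ▸ hleaf i, fun hv => h1 v hv⟩

end WeightedTree

/-! ### Reduction to pseudostars -/

namespace LeafTree

open SimpleGraph WeightedTree

variable {n k : ℕ} {T : LeafTree n}

lemma pend_ne {a b : T.V} (ha : ¬ T.IsLeaf a) (hb : ¬ T.IsLeaf b) (i : Fin n) :
    T.pend i ≠ s(a, b) := by
  intro he
  rcases Sym2.eq_iff.1 he with ⟨h, -⟩ | ⟨h, -⟩
  · exact ha (h ▸ T.isLeaf_leaf i)
  · exact hb (h ▸ T.isLeaf_leaf i)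

/-- In an essential tree every edge between two nodes can be contracted. -/
lemma exists_isContraction (hT : T.IsEssential) (hn : 3 ≤ n) {a b : T.V} (hab : T.graph.Adj a b)
    (ha : ¬ T.IsLeaf a) (hb : ¬ T.IsLeaf b) (w : Sym2 T.V → ℝ) :
    ∃ (T' : LeafTree n) (φ : T.V → T'.V),
      IsContraction T.toWeightedTree T'.toWeightedTree a b φ ∧ (∀ i, φ (T.leaf i) = T'.leaf i) ∧
      (∀ e ∈ T.graph.edgeSet, e ≠ s(a, b) → T'.weight (e.map φ) = w e) ∧
      T'.IsEssential ∧ Fintype.card T'.V < Fintype.card T.V := by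
  obtain ⟨T', φ, h, hw, hlt⟩ := T.toWeightedTree.exists_isContraction hab w
  have ha' := (isLeaf_or_isNode hT hn a).resolve_left ha
  have hb' := (isLeaf_or_isNode hT hn b).resolve_left hb
  have hla : ∀ {v}, T.IsLeaf v → v ≠ a := fun hl he => ha (he ▸ hl)
  have hlb : ∀ {v}, T.IsLeaf v → v ≠ b := fun hl he => hb (he ▸ hl)
  have hdeg : ∀ v, T'.deg (φ v) = T.deg v ∨ (v = a ∨ v = b) ∧ 2 < T'.deg (φ v) := by
    intro v
    have h2 := h.deg_add_two
    unfold IsNode at ha' hb'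
    by_cases hva : v = a
    · subst hva
      exact Or.inr ⟨Or.inl rfl, by omega⟩
    by_cases hvb : v = b
    · subst hvb
      rw [h.map_left_eq] at h2
      exact Or.inr ⟨Or.inr rfl, by omega⟩
    exact Or.inl (h.deg_of_ne hva hvb)
  refine ⟨{ toWeightedTree := T', leaf := φ ∘ T.leaf, leaf_injective := ?_, range_leaf := ?_ },
    φ, h, fun i => rfl, hw, ?_, hlt⟩
  · intro i j hij
    exact T.leaf_injective (h.eq_of_map_eq (hla (T.isLeaf_leaf i)) (hlb (T.isLeaf_leaf i)) hij)
  · ext y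
    constructor
    · rintro ⟨i, rfl⟩
      have hi := T.isLeaf_leaf i
      change T'.deg (φ (T.leaf i)) = 1
      rw [h.deg_of_ne (hla hi) (hlb hi)]
      exact hi
    · intro hy
      obtain ⟨v, rfl⟩ := h.surjective y
      change T'.deg (φ v) = 1 at hy
      rcases hdeg v with hv | ⟨-, hv⟩
      · obtain ⟨i, rfl⟩ := exists_leaf_eq (show T.IsLeaf v from hv.symm.trans hy)
        exact ⟨i, rfl⟩
      · omega
  · intro y
    obtain ⟨v, rfl⟩ := h.surjective y
    rcases hdeg v with hv | ⟨-, hv⟩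
    · exact hv.symm ▸ hT v
    · exact hv.ne'

lemma pend_eq_map {T' : LeafTree n} {a b : T.V} {φ : T.V → T'.V}
    (h : IsContraction T.toWeightedTree T'.toWeightedTree a b φ)
    (hleaf : ∀ i, φ (T.leaf i) = T'.leaf i) (ha : ¬ T.IsLeaf a) (hb : ¬ T.IsLeaf b) (i : Fin n) :
    T'.pend i = (T.pend i).map φ := by
  have hadj := h.map_adj (T.adj_nbr i) (pend_ne ha hb i)
  rw [hleaf] at hadj
  rw [pend, pend, Sym2.map_mk, hleaf, eq_nbr hadj]

lemma not_isLeaf_of_ncard_side (hkn : k < n) {a b : T.V} (hab : T.graph.Adj a b)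
    (h : (T.side b a).ncard < k) : ¬ T.IsLeaf a := by
  intro ha
  obtain ⟨i, -, -, hi⟩ := side_eq_of_isLeaf hab ha
  have := Set.ncard_add_ncard_compl (T.side a b)
  rw [← side_swap hab, hi, Set.ncard_singleton] at this
  simp at this
  omega

lemma exists_mem_notMem_of_ncard_lt {I : Finset (Fin n)} {S : Set (Fin n)} (hI : I.card = k)
    (h1 : S.ncard < k) (h2 : Sᶜ.ncard < k) : (∃ i ∈ I, i ∈ S) ∧ ∃ i ∈ I, i ∉ S := by
  have key : ∀ S : Set (Fin n), S.ncard < k → ∃ i ∈ I, i ∉ S := by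
    intro S hS
    by_contra hcon
    push Not at hcon
    have := Set.ncard_le_ncard (s := (I : Set (Fin n))) (t := S) hcon (Set.toFinite _)
    rw [Set.ncard_coe_finset] at this
    omega
  refine ⟨?_, key S h1⟩
  obtain ⟨i, hi, hiS⟩ := key _ h2
  exact ⟨i, hi, by simpa using hiS⟩

open Classical in
/-- An edge that divides `[n]` into two sets with fewer than `k` elements can be contracted by a
`k`-IO operation, and this does not change the `k`-weights. The edge is separated by every
`k`-subset, and so are exactly `k` of the twigs. -/
lemma exists_isIO (hk : 3 ≤ k) (hkn : k < n) (hT : T.IsEssential) {a b : T.V}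
    (hab : T.graph.Adj a b) (h1 : (T.side a b).ncard < k) (h2 : (T.side b a).ncard < k) :
    ∃ T' : LeafTree n, IsIO k T T' ∧ T'.IsEssential ∧ Fintype.card T'.V < Fintype.card T.V ∧
      (∀ D : KSubset n k → ℝ, T.Realizes D → T'.Realizes D) ∧ (T.IsPositive → T'.IsPositive) := by
  have hn : 3 ≤ n := by omega
  have ha := not_isLeaf_of_ncard_side hkn hab h2
  have hb := not_isLeaf_of_ncard_side hkn hab.symm h1
  obtain ⟨T', φ, h, hleaf, hw, hT', hlt⟩ := exists_isContraction hT hn hab ha hb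
    (fun e => T.weight e + ∑ i, if e = T.pend i then T.weight s(a, b) / k else 0)
  have hk0 : (k : ℝ) ≠ 0 := by positivity
  refine ⟨T', ⟨a, b, φ, h, hleaf, h1, h2, ?_, ?_⟩, hT', hlt, ?_, ?_⟩
  · intro i
    rw [twigWeight_eq hT' hn, twigWeight_eq hT hn, pend_eq_map h hleaf ha hb,
      hw _ (T.adj_nbr i) (pend_ne ha hb i)]
    simp [(pend_injective hn).eq_iff]
  · intro u v huv hne
    obtain ⟨huv, hu, hv⟩ := (isInternal_iff hT hn).1 huv
    have := hw s(u, v) huv hne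
    rw [Sym2.map_mk] at this
    rw [this, Finset.sum_eq_zero, add_zero]
    intro i _
    rw [if_neg (pend_ne hu hv i).symm]
  · intro D hD I
    have hI : 2 ≤ I.1.card := by rw [I.2]; omega
    rw [← hD I]
    have himg : T'.leaf '' (I.1 : Set (Fin n)) = φ '' (T.leaf '' (I.1 : Set (Fin n))) := by
      rw [Set.image_image]
      exact Set.image_congr fun i _ => (hleaf i).symm
    rw [himg, h.multiweight_eq hw, multiweight]
    -- The sum becomes that of `T`, plus the terms added to the twigs, minus the weight of `{a, b}`.
    have hsum : ∀ e : Sym2 T.V, (if e = s(a, b) then 0 else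
        T.weight e + ∑ i, if e = T.pend i then T.weight s(a, b) / k else 0) = T.weight e +
          ((∑ i, if e = T.pend i then T.weight s(a, b) / k else 0) -
            if e = s(a, b) then T.weight s(a, b) else 0) := by
      intro e
      by_cases he : e = s(a, b)
      · subst he
        rw [Finset.sum_eq_zero fun i _ => if_neg (pend_ne ha hb i).symm]
        simp
      · simp [he]
    simp_rw [hsum]
    rw [Finset.sum_add_distrib, Finset.sum_sub_distrib, Finset.sum_comm, Finset.sum_ite_eq']
    simp_rw [Finset.sum_ite_eq']
    simp only [Finset.mem_filter, Finset.mem_univ, true_and]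
    simp_rw [pend_mem_edgeSet_minimalSubtree hI]
    rw [if_pos ((mem_edgeSet_minimalSubtree hab).2
      (exists_mem_notMem_of_ncard_lt I.2 h1 (side_swap hab ▸ h2))), Finset.sum_ite_mem]
    simp only [Finset.univ_inter, Finset.sum_const, I.2, nsmul_eq_mul]
    field_simp
    ring
  · intro hpos
    refine h.isPositive hw fun e he => ?_
    have h3 := hpos e he
    have h4 := hpos s(a, b) hab
    have h5 : 0 ≤ ∑ i, if e = T.pend i then T.weight s(a, b) / k else 0 :=
      Finset.sum_nonneg fun i _ => by positivity
    linarith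

lemma exists_isZeroInsertion (hn : 3 ≤ n) (hT : T.IsEssential) {a b : T.V}
    (hab : T.IsInternal s(a, b)) (h0 : T.weight s(a, b) = 0) :
    ∃ T' : LeafTree n, IsZeroInsertion T' T ∧ T'.IsEssential ∧
      Fintype.card T'.V < Fintype.card T.V ∧
      ∀ k, ∀ D : KSubset n k → ℝ, T.Realizes D → T'.Realizes D := by
  classical
  obtain ⟨hadj, ha, hb⟩ := (isInternal_iff hT hn).1 hab
  obtain ⟨T', φ, h, hleaf, hw, hT', hlt⟩ := exists_isContraction hT hn hadj ha hb T.weight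
  refine ⟨T', ⟨a, b, φ, h, hleaf, hab, h0, fun u v huv hne => hw s(u, v) huv hne⟩, hT', hlt, ?_⟩
  intro k D hD I
  have himg : T'.leaf '' (I.1 : Set (Fin n)) = φ '' (T.leaf '' (I.1 : Set (Fin n))) := by
    rw [Set.image_image]
    exact Set.image_congr fun i _ => (hleaf i).symm
  rw [← hD I, himg, h.multiweight_eq hw, multiweight]
  refine Finset.sum_congr rfl fun e _ => ?_
  split_ifs with he
  · rw [he, h0]
  · rfl

/-- Every essential tree realizing a family is obtained by `k`-OI operations and insertions of edges
of weight `0` from a pseudostar of the kind sought. -/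
lemma exists_isRealizingPseudostar (hk : 3 ≤ k) (hkn : k < n) {D : KSubset n k → ℝ}
    (T : LeafTree n) (hT : T.IsEssential) (hD : T.Realizes D) :
    ∃ Q : LeafTree n, Q.IsRealizingPseudostar D ∧
      Relation.ReflTransGen (fun A B : LeafTree n => IsOI k A B ∨ IsZeroInsertion A B) Q T ∧
      (T.IsPositive →
        Q.IsPositive ∧ Relation.ReflTransGen (fun A B : LeafTree n => IsOI k A B) Q T) := by
  have hn : 3 ≤ n := by omega
  induction hN : Fintype.card T.V using Nat.strong_induction_on generalizing T with
  | _ N ih =>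
    subst hN
    by_cases hstar : T.IsPseudostar k
    · by_cases hnz : T.IsInternalNonzero
      · exact ⟨T, ⟨hnz, hT, hstar, hD⟩, .refl, fun hpos => ⟨hpos, .refl⟩⟩
      · unfold IsInternalNonzero at hnz
        push Not at hnz
        obtain ⟨⟨a, b⟩, hab, h0⟩ := hnz
        obtain ⟨T', hZ, hT', hlt, hD'⟩ := exists_isZeroInsertion hn hT hab h0
        obtain ⟨Q, hQ, hr, -⟩ := ih _ hlt T' hT' (hD' k D hD) rfl
        exact ⟨Q, hQ, hr.tail (Or.inr hZ), fun hpos => absurd h0 (hpos _ hab.1).ne'⟩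
    · unfold IsPseudostar at hstar
      push Not at hstar
      obtain ⟨a, b, hab, h1, h2⟩ := hstar
      obtain ⟨T', hstep, hT', hlt, hD', hpos'⟩ := exists_isIO hk hkn hT hab h1 h2
      obtain ⟨Q, hQ, hr, hr'⟩ := ih _ hlt T' hT' (hD' D hD) rfl
      exact ⟨Q, hQ, hr.tail (Or.inl hstep), fun hpos =>
        ⟨(hr' (hpos' hpos)).1, (hr' (hpos' hpos)).2.tail hstep⟩⟩

end LeafTree

/-! ### Quartets -/

namespace LeafTree

open SimpleGraph WeightedTree

variable {n k : ℕ} {T T' : LeafTree n}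

/-- Some edge of `T` has `X` on one side and `Y` on the other. -/
def Separates (T : LeafTree n) (X Y : Set (Fin n)) : Prop :=
  ∃ a b, T.graph.Adj a b ∧ X ⊆ T.side a b ∧ Y ⊆ T.side b a

/-- Every side of an edge that contains the leaves `i` and `j` contains the vertex `a`; in other
words, `a` lies on the path from `i` to `j`. -/
def Spans (T : LeafTree n) (a : T.V) (i j : Fin n) : Prop :=
  ∀ c d, T.graph.Adj c d → i ∈ T.side c d → j ∈ T.side c d → a ∈ T.graph.edgeComp c d

lemma side_compat {a b c d : T.V} (hab : T.graph.Adj a b) (hcd : T.graph.Adj c d) :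
    T.side c d ⊆ T.side a b ∨ T.side d c ⊆ T.side a b ∨
      T.side c d ⊆ T.side b a ∨ T.side d c ⊆ T.side b a := by
  have key : ∀ {a b c d : T.V}, T.graph.edgeComp c d ⊆ T.graph.edgeComp a b →
      T.side c d ⊆ T.side a b := fun h _ hi => h hi
  rcases T.isTree.edgeComp_compat hab hcd with h | h | h | h
  · exact Or.inl (key h)
  · exact Or.inr (Or.inl (key h))
  · exact Or.inr (Or.inr (Or.inl (key h)))
  · exact Or.inr (Or.inr (Or.inr (key h)))

namespace Separates

variable {X X' Y Y' : Set (Fin n)}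

lemma symm (h : T.Separates X Y) : T.Separates Y X := by
  obtain ⟨a, b, hab, hX, hY⟩ := h
  exact ⟨b, a, hab.symm, hY, hX⟩

/-- If `X` and `X'` meet, the sides that separate them from `Y` are nested, and the larger one
separates both. -/
lemma union (h : T.Separates X Y) (h' : T.Separates X' Y) (hX : (X ∩ X').Nonempty)
    (hY : Y.Nonempty) : T.Separates (X ∪ X') Y := by
  obtain ⟨a, b, hab, hXa, hYa⟩ := h
  obtain ⟨c, d, hcd, hXc, hYc⟩ := h'
  obtain ⟨x, hx, hx'⟩ := hX
  obtain ⟨y, hy⟩ := hY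
  rcases side_compat hab hcd with h | h | h | h
  · exact ⟨a, b, hab, Set.union_subset hXa (hXc.trans h), hYa⟩
  · exact absurd (h (hYc hy)) ((mem_side_swap hab).1 (hYa hy))
  · exact absurd (hXa hx) ((mem_side_swap hab).1 (h (hXc hx')))
  · refine ⟨c, d, hcd, Set.union_subset (hXa.trans fun i hi => ?_) hXc, hYc⟩
    by_contra hi'
    exact (mem_side_swap hab).1 (h ((mem_side_swap hcd).2 hi')) hi

lemma mono (h : T.Separates X Y) (hX : X' ⊆ X) (hY : Y' ⊆ Y) : T.Separates X' Y' := by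
  obtain ⟨a, b, hab, hXa, hYa⟩ := h
  exact ⟨a, b, hab, hX.trans hXa, hY.trans hYa⟩

/-- If every two elements of `X` are separated from `Y` by an edge, one edge does so for all
of `X`. -/
lemma of_pairs (hX : X.Nonempty) (hY : Y.Nonempty)
    (h : ∀ i ∈ X, ∀ j ∈ X, T.Separates {i, j} Y) : T.Separates X Y := by
  obtain ⟨i, hi⟩ := hX
  have key : ∀ S : Set (Fin n), S.Finite → S ⊆ X → T.Separates (insert i S) Y := by
    intro S hS
    induction S, hS using Set.Finite.induction_on with
    | empty =>
      intro _
      simpa using h i hi i hi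
    | @insert j S _ _ ih =>
      intro hSX
      refine ((ih ((Set.subset_insert _ _).trans hSX)).union
        (h i hi j (hSX (Set.mem_insert _ _))) ⟨i, by simp, by simp⟩ hY).mono ?_ subset_rfl
      intro x hx
      simp only [Set.mem_insert_iff, Set.mem_union, Set.mem_singleton_iff] at hx ⊢
      tauto
  exact (key X (Set.toFinite _) subset_rfl).mono (Set.subset_insert _ _) subset_rfl

/-- Of the three ways to split four leaves into pairs, at most one is displayed. -/
lemma not_separates {i j l m : Fin n} (h : T.Separates {i, j} {l, m}) :
    ¬ T.Separates {i, l} {j, m} := by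
  intro h'
  obtain ⟨a, b, hab, hij, hlm⟩ := h
  obtain ⟨c, d, hcd, hil, hjm⟩ := h'
  simp only [Set.insert_subset_iff, Set.singleton_subset_iff, mem_side_swap hab,
    mem_side_swap hcd] at hij hlm hil hjm
  rcases side_compat hab hcd with h | h | h | h
  · exact hlm.1 (h hil.2)
  · exact hlm.2 (h ((mem_side_swap hcd).2 hjm.2))
  · exact (mem_side_swap hab).1 (h hil.1) hij.1
  · exact (mem_side_swap hab).1 (h ((mem_side_swap hcd).2 hjm.1)) hij.2

end Separates

section QuartetSum

variable (T) in
open Classical in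
/-- The contribution of the edge `e` to the multiweight of the leaves `I`. -/
noncomputable def term (I : Finset (Fin n)) (e : Sym2 T.V) : ℝ :=
  if e ∈ (T.minimalSubtree (T.leaf '' (I : Set (Fin n)))).edgeSet then T.weight e else 0

lemma multiweight_eq_sum_term (I : Finset (Fin n)) :
    T.multiweight (T.leaf '' (I : Set (Fin n))) = ∑ e : Sym2 T.V, T.term I e := by
  rw [multiweight, Finset.sum_filter]
  rfl

lemma term_of_notMem (I : Finset (Fin n)) {e : Sym2 T.V} (he : e ∉ T.graph.edgeSet) :
    T.term I e = 0 :=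
  if_neg fun h => he (T.edgeSet_minimalSubtree_subset h)

open Classical in
lemma term_insert_insert (R : Finset (Fin n)) (i j : Fin n) {a b : T.V} (hab : T.graph.Adj a b) :
    T.term (insert i (insert j R)) s(a, b) =
      if (i ∈ T.side a b ∨ j ∈ T.side a b ∨ ∃ r ∈ R, r ∈ T.side a b) ∧
        (i ∉ T.side a b ∨ j ∉ T.side a b ∨ ∃ r ∈ R, r ∉ T.side a b) then
        T.weight s(a, b) else 0 := by
  unfold term
  rw [mem_edgeSet_minimalSubtree hab]
  simp only [Finset.exists_mem_insert]

variable (T) in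
/-- The sum of the multiweights of `{i, j} ∪ R` and `{l, m} ∪ R`. -/
noncomputable def pairSum (R : Finset (Fin n)) (i j l m : Fin n) : ℝ :=
  T.multiweight (T.leaf '' ((insert i (insert j R) : Finset (Fin n)) : Set (Fin n))) +
    T.multiweight (T.leaf '' ((insert l (insert m R) : Finset (Fin n)) : Set (Fin n)))

lemma pairSum_eq (R : Finset (Fin n)) (i j l m : Fin n) : T.pairSum R i j l m =
    ∑ e : Sym2 T.V, (T.term (insert i (insert j R)) e + T.term (insert l (insert m R)) e) := by
  rw [pairSum, multiweight_eq_sum_term, multiweight_eq_sum_term, Finset.sum_add_distrib]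

lemma pairSum_swap (R : Finset (Fin n)) (i j l m : Fin n) :
    T.pairSum R i j l m = T.pairSum R i j m l := by
  rw [pairSum, pairSum, Finset.insert_comm l m]

/-- An edge contributes differently to the sums of two pairings only if it displays one of
them. -/
lemma term_add_term_eq (R : Finset (Fin n)) {i j l m : Fin n} {a b : T.V}
    (hab : T.graph.Adj a b)
    (h1 : ¬ (i ∈ T.side a b ∧ j ∈ T.side a b ∧ l ∉ T.side a b ∧ m ∉ T.side a b))
    (h2 : ¬ (i ∉ T.side a b ∧ j ∉ T.side a b ∧ l ∈ T.side a b ∧ m ∈ T.side a b))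
    (h3 : ¬ (i ∈ T.side a b ∧ j ∉ T.side a b ∧ l ∈ T.side a b ∧ m ∉ T.side a b))
    (h4 : ¬ (i ∉ T.side a b ∧ j ∈ T.side a b ∧ l ∉ T.side a b ∧ m ∈ T.side a b)) :
    T.term (insert i (insert l R)) s(a, b) + T.term (insert j (insert m R)) s(a, b) =
      T.term (insert i (insert j R)) s(a, b) + T.term (insert l (insert m R)) s(a, b) := by
  simp only [term_insert_insert R _ _ hab]
  by_cases hp : ∃ r ∈ R, r ∈ T.side a b <;> by_cases hq : ∃ r ∈ R, r ∉ T.side a b <;>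
    by_cases hi : i ∈ T.side a b <;> by_cases hj : j ∈ T.side a b <;>
    by_cases hl : l ∈ T.side a b <;> by_cases hm : m ∈ T.side a b <;>
    simp only [hp, hq, hi, hj, hl, hm, not_true, not_false_eq_true, and_true, and_false,
      or_true, or_false, if_true, if_false] at h1 h2 h3 h4 ⊢ <;>
    ring

lemma not_side_of_not_separates {i j l m : Fin n} (h : ¬ T.Separates {i, j} {l, m}) {a b : T.V}
    (hab : T.graph.Adj a b) :
    ¬ (i ∈ T.side a b ∧ j ∈ T.side a b ∧ l ∉ T.side a b ∧ m ∉ T.side a b) := by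
  rintro ⟨hi, hj, hl, hm⟩
  refine h ⟨a, b, hab, ?_, ?_⟩ <;>
    simp only [Set.insert_subset_iff, Set.singleton_subset_iff, mem_side_swap hab]
  exacts [⟨hi, hj⟩, ⟨hl, hm⟩]

/-- If neither `ij|lm` nor `il|jm` is displayed, the two pairings have the same sum. -/
lemma pairSum_eq_of_not_separates (R : Finset (Fin n)) {i j l m : Fin n}
    (h1 : ¬ T.Separates {i, j} {l, m}) (h2 : ¬ T.Separates {i, l} {j, m}) :
    T.pairSum R i l j m = T.pairSum R i j l m := by
  rw [pairSum_eq, pairSum_eq]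
  refine Finset.sum_congr rfl fun e _ => ?_
  by_cases he : e ∈ T.graph.edgeSet
  · obtain ⟨a, b⟩ := e
    have h3 := not_side_of_not_separates (fun h => h1 h.symm) he
    have h4 := not_side_of_not_separates (fun h => h2 h.symm) he
    have h5 := not_side_of_not_separates h1 he
    have h6 := not_side_of_not_separates h2 he
    exact term_add_term_eq R he h5 (by tauto) (by tauto) (by tauto)
  · simp only [term_of_notMem _ he]

variable {a b : T.V} {i j l m : Fin n}

/-- If `a` is on the path from `i` to `j` and `b` on the path from `l` to `m`, then the edge
`{a, b}` is the only one that can separate `i, j` from `l, m`. -/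
lemma Spans.eq_of_side (hab : T.graph.Adj a b) (hij : T.Spans a i j) (hlm : T.Spans b l m)
    {c d : T.V} (hcd : T.graph.Adj c d) (hi : i ∈ T.side c d) (hj : j ∈ T.side c d)
    (hl : l ∉ T.side c d) (hm : m ∉ T.side c d) : a = c ∧ b = d :=
  T.isTree.eq_of_adj_of_mem hab hcd (hij c d hcd hi hj)
    (hlm d c hcd.symm ((mem_side_swap hcd).2 hl) ((mem_side_swap hcd).2 hm))

/-- The weight of an edge `{a, b}` in terms of multiweights. Since `R` lies on the side of `b`, the
set `{l, m} ∪ R` is not separated by the edge, whereas `{i, j} ∪ R` is. -/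
lemma pairSum_sub_pairSum (hab : T.graph.Adj a b) (hij : T.Spans a i j) (hlm : T.Spans b l m)
    (hi : i ∈ T.side a b) (hj : j ∈ T.side a b) (hl : l ∈ T.side b a) (hm : m ∈ T.side b a)
    {R : Finset (Fin n)} (hR : R.Nonempty) (hRb : ∀ r ∈ R, r ∈ T.side b a) :
    T.pairSum R i l j m - T.pairSum R i j l m = T.weight s(a, b) := by
  classical
  rw [mem_side_swap hab] at hl hm
  have hsep : T.Separates {i, j} {l, m} := by
    refine ⟨a, b, hab, ?_, ?_⟩ <;>
      simp only [Set.insert_subset_iff, Set.singleton_subset_iff, mem_side_swap hab]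
    exacts [⟨hi, hj⟩, ⟨hl, hm⟩]
  have hns := hsep.not_separates
  rw [pairSum_eq, pairSum_eq, ← Finset.sum_sub_distrib, Finset.sum_eq_single s(a, b)]
  · simp only [term_insert_insert R _ _ hab]
    have h1 : ¬ ∃ r ∈ R, r ∈ T.side a b := fun ⟨r, hr, h⟩ => (mem_side_swap hab).1 (hRb r hr) h
    have h2 : ∃ r ∈ R, r ∉ T.side a b := by
      obtain ⟨r, hr⟩ := hR
      exact ⟨r, hr, (mem_side_swap hab).1 (hRb r hr)⟩
    simp only [hi, hj, hl, hm, h1, h2]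
    norm_num
  · rintro ⟨c, d⟩ - hne
    by_cases he : s(c, d) ∈ T.graph.edgeSet
    · have h6 := not_side_of_not_separates hns he
      have h4 := not_side_of_not_separates (fun h => hns h.symm) he
      have he' : T.graph.Adj c d := he
      refine sub_eq_zero.2 (term_add_term_eq R he (fun h => ?_) (fun h => ?_) (by tauto)
        (by tauto))
      · obtain ⟨rfl, rfl⟩ := hij.eq_of_side hab hlm he h.1 h.2.1 h.2.2.1 h.2.2.2
        exact hne rfl
      · have hs := fun {x} => mem_side_swap he' (i := x)
        obtain ⟨rfl, rfl⟩ := hij.eq_of_side hab hlm he'.symm (hs.2 h.1) (hs.2 h.2.1)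
          (fun h' => hs.1 h' h.2.2.1) (fun h' => hs.1 h' h.2.2.2)
        exact hne Sym2.eq_swap
    · change _ - _ = (0 : ℝ)
      simp only [term_of_notMem _ he]
      norm_num
  · simp

end QuartetSum

section Spans

variable {a b : T.V}

lemma spans_of_branches {x y : T.V} (hx : T.graph.Adj x a) (hy : T.graph.Adj y a) (hxy : x ≠ y)
    {i j : Fin n} (hi : T.leaf i ∈ T.graph.edgeComp x a) (hj : T.leaf j ∈ T.graph.edgeComp y a) :
    T.Spans a i j := by
  intro c d hcd hic hjc
  by_contra ha
  rw [← T.isTree.mem_edgeComp_swap hcd] at ha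
  have key : ∀ {x : T.V} {i : Fin n}, T.graph.Adj x a → T.leaf i ∈ T.graph.edgeComp x a →
      i ∈ T.side c d → c ∈ T.graph.edgeComp x a := by
    intro x i hx hi hic
    by_contra hc
    exact (mem_side_swap hcd).1 (branch_subset hx hcd.symm ha hc hi) hic
  exact T.isTree.branch_disjoint hx hy hxy (key hx hi hic) (key hy hj hjc)

lemma Spans.ne (h : T.Spans a i j) (ha : ¬ T.IsLeaf a) : i ≠ j := by
  rintro rfl
  have := h _ _ (T.adj_nbr i) (left_mem_edgeComp _ _ _) (left_mem_edgeComp _ _ _)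
  rw [(T.isLeaf_leaf i).edgeComp_eq (T.adj_nbr i)] at this
  exact ha (this ▸ T.isLeaf_leaf i)

/-- Any two leaves on the side of `a` are joined through `a` directly, or via a third leaf. -/
lemma exists_spans (hab : T.graph.Adj a b) (ha : T.IsNode a) {i i' : Fin n}
    (hi : i ∈ T.side a b) (hi' : i' ∈ T.side a b) :
    T.Spans a i i' ∨ ∃ j ∈ T.side a b, T.Spans a i j ∧ T.Spans a i' j := by
  have hne : ∀ i, T.leaf i ≠ a := by
    rintro i rfl
    have := T.isLeaf_leaf i
    unfold IsLeaf at this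
    unfold IsNode at ha
    omega
  obtain ⟨x, hx, hix⟩ := T.isTree.exists_branch (hne i)
  obtain ⟨x', hx', hix'⟩ := T.isTree.exists_branch (hne i')
  by_cases hxx : x = x'
  · subst hxx
    obtain ⟨y, hy, hyx, hyb⟩ := ha.exists_branch_ne x b
    obtain ⟨u, hu, hul⟩ := exists_leaf_mem_edgeComp hy
    obtain ⟨j, rfl⟩ := exists_leaf_eq hul
    refine Or.inr ⟨j, ?_, spans_of_branches hx hy hyx.symm hix hu,
      spans_of_branches hx hy hyx.symm hix' hu⟩
    exact branch_subset hy hab (left_mem_edgeComp _ _ _)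
      (T.isTree.branch_disjoint hab.symm hy hyb.symm (left_mem_edgeComp _ _ _)) hu
  · exact Or.inl (spans_of_branches hx hx' hxx hix hix')

lemma exists_spans_pair (hab : T.graph.Adj a b) (ha : T.IsNode a) :
    ∃ i ∈ T.side a b, ∃ j ∈ T.side a b, T.Spans a i j := by
  obtain ⟨i, hi⟩ := side_nonempty hab
  rcases exists_spans hab ha hi hi with h | ⟨j, hj, h, -⟩
  · exact ⟨i, hi, i, hi, h⟩
  · exact ⟨i, hi, j, hj, h⟩

end Spans

/-! ### Multiweights determine the splits of a pseudostar -/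

section Transfer

variable {a b : T.V} {i j l m : Fin n}

/-- A set of at least `k` leaves has room for `k - 2` leaves other than `l` and `m`. -/
lemma exists_subset_side {S : Set (Fin n)} (hS : k ≤ S.ncard) (l m : Fin n) :
    ∃ R : Finset (Fin n), R.card = k - 2 ∧ (∀ r ∈ R, r ∈ S) ∧ l ∉ R ∧ m ∉ R := by
  classical
  have h1 : k - 2 ≤ ((S.toFinset.erase l).erase m).card := by
    have h2 := Finset.pred_card_le_card_erase (s := S.toFinset) (a := l)
    have h3 := Finset.pred_card_le_card_erase (s := S.toFinset.erase l) (a := m)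
    rw [Set.ncard_eq_toFinset_card'] at hS
    omega
  obtain ⟨R, hR, hcard⟩ := Finset.exists_subset_card_eq h1
  refine ⟨R, hcard, fun r hr => ?_, fun hl => ?_, fun hm => ?_⟩
  · simpa using Finset.mem_of_mem_erase (Finset.mem_of_mem_erase (hR hr))
  · exact absurd rfl (Finset.ne_of_mem_erase (Finset.mem_of_mem_erase (hR hl)))
  · exact absurd rfl (Finset.ne_of_mem_erase (hR hm))

lemma pairSum_congr (hk : 2 ≤ k)
    (hmw : ∀ I : Finset (Fin n), I.card = k → T.multiweight (T.leaf '' (I : Set (Fin n))) =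
      T'.multiweight (T'.leaf '' (I : Set (Fin n))))
    {R : Finset (Fin n)} (hR : R.card = k - 2) (hij : i ≠ j) (hlm : l ≠ m) (hi : i ∉ R)
    (hj : j ∉ R) (hl : l ∉ R) (hm : m ∉ R) : T.pairSum R i j l m = T'.pairSum R i j l m := by
  unfold pairSum
  rw [hmw, hmw]
  · rw [Finset.card_insert_of_notMem (by simp [hlm, hl]), Finset.card_insert_of_notMem hm]
    omega
  · rw [Finset.card_insert_of_notMem (by simp [hij, hi]), Finset.card_insert_of_notMem hj]
    omega

variable (hk : 3 ≤ k) (hmw : ∀ I : Finset (Fin n), I.card = k →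
  T.multiweight (T.leaf '' (I : Set (Fin n))) = T'.multiweight (T'.leaf '' (I : Set (Fin n))))
include hk hmw

/-- A quartet around an edge of nonzero weight is displayed by every tree with the same
`k`-weights. -/
lemma separates_of_spans (hab : T.graph.Adj a b) (ha : ¬ T.IsLeaf a) (hb : ¬ T.IsLeaf b)
    (h0 : T.weight s(a, b) ≠ 0) (hside : k ≤ (T.side b a).ncard) (hij : T.Spans a i j)
    (hlm : T.Spans b l m) (hi : i ∈ T.side a b) (hj : j ∈ T.side a b) (hl : l ∈ T.side b a)
    (hm : m ∈ T.side b a) : T'.Separates {i, j} {l, m} := by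
  obtain ⟨R, hR, hRb, hlR, hmR⟩ := exists_subset_side hside l m
  have hR0 : R.Nonempty := Finset.card_pos.1 (by omega)
  have h1 := pairSum_sub_pairSum hab hij hlm hi hj hl hm hR0 hRb
  have hsep : T.Separates {i, j} {l, m} := ⟨a, b, hab,
    by simp [Set.insert_subset_iff, hi, hj], by simp [Set.insert_subset_iff, hl, hm]⟩
  have hsep' : T.Separates {i, j} {m, l} := by rwa [Set.pair_comm m l]
  have h2 : T.pairSum R i l j m = T.pairSum R i m j l := by
    rw [pairSum_swap R i l j m, pairSum_swap R i m j l]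
    exact pairSum_eq_of_not_separates R
      (fun h => hsep'.not_separates (by rwa [Set.pair_comm l j] at h))
      (fun h => hsep.not_separates (by rwa [Set.pair_comm m j] at h))
  have hnot : ∀ {x y : Fin n}, x ∈ T.side a b → y ∈ T.side b a → x ≠ y := by
    rintro x y hx hy rfl
    exact (mem_side_swap hab).1 hy hx
  have hnR : ∀ {x : Fin n}, x ∈ T.side a b → x ∉ R := fun hx hxR => hnot hx (hRb _ hxR) rfl
  have hk2 : 2 ≤ k := by omega
  rw [pairSum_congr hk2 hmw hR (hnot hi hl) (hnot hj hm) (hnR hi) hlR (hnR hj) hmR] at h1 h2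
  rw [pairSum_congr hk2 hmw hR (hij.ne ha) (hlm.ne hb) (hnR hi) (hnR hj) hlR hmR] at h1
  rw [pairSum_congr hk2 hmw hR (hnot hi hm) (hnot hj hl) (hnR hi) hmR (hnR hj) hlR] at h2
  -- If `ij|lm` is not displayed, then one of the two other pairings is not displayed either, and
  -- its sum agrees with that of `ij|lm`.
  by_contra hns
  by_cases h3 : T'.Separates {i, l} {j, m}
  · have h4 := pairSum_eq_of_not_separates (T := T') R (i := i) (j := j) (l := m) (m := l)
      (by rwa [Set.pair_comm m l]) (fun h => by
        have h5 : T'.Separates {i, l} {m, j} := by rwa [Set.pair_comm m j]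
        exact h5.not_separates (by rwa [Set.pair_comm l j]))
    rw [pairSum_swap R i j m l] at h4
    exact h0 (by linarith)
  · have h4 := pairSum_eq_of_not_separates R hns h3
    exact h0 (by linarith)

/-- An internal edge of nonzero weight with at least `k` leaves on the side of `b` has a counterpart
with the same split in every tree with the same `k`-weights. -/
lemma exists_side_eq_of_le (hab : T.graph.Adj a b) (ha : T.IsNode a) (hb : T.IsNode b)
    (h0 : T.weight s(a, b) ≠ 0) (hside : k ≤ (T.side b a).ncard) :
    ∃ c d, T'.graph.Adj c d ∧ T'.side c d = T.side a b := by
  have hnl : ∀ {v}, T.IsNode v → ¬ T.IsLeaf v := by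
    intro v h1 h2
    unfold IsNode at h1
    unfold IsLeaf at h2
    omega
  have h1 : ∀ i ∈ T.side a b, ∀ i' ∈ T.side a b, ∀ l ∈ T.side b a, ∀ m ∈ T.side b a,
      T.Spans b l m → T'.Separates {i, i'} {l, m} := by
    intro i hi i' hi' l hl m hm hlm
    have key : ∀ {i j}, i ∈ T.side a b → j ∈ T.side a b → T.Spans a i j →
        T'.Separates {i, j} {l, m} := fun hi hj hij =>
      separates_of_spans hk hmw hab (hnl ha) (hnl hb) h0 hside hij hlm hi hj hl hm
    rcases exists_spans hab ha hi hi' with h | ⟨j, hj, h, h'⟩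
    · exact key hi hi' h
    · exact ((key hi hj h).union (key hi' hj h') ⟨j, by simp, by simp⟩ ⟨l, by simp⟩).mono
        (by intro x hx; simp only [Set.mem_insert_iff, Set.mem_singleton_iff, Set.mem_union] at *
            tauto) subset_rfl
  have h2 : ∀ i ∈ T.side a b, ∀ i' ∈ T.side a b, ∀ l ∈ T.side b a, ∀ l' ∈ T.side b a,
      T'.Separates {l, l'} {i, i'} := by
    intro i hi i' hi' l hl l' hl'
    rcases exists_spans hab.symm hb hl hl' with h | ⟨m, hm, h, h'⟩
    · exact (h1 i hi i' hi' l hl l' hl' h).symm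
    · exact ((h1 i hi i' hi' l hl m hm h).symm.union (h1 i hi i' hi' l' hl' m hm h').symm
        ⟨m, by simp, by simp⟩ ⟨i, by simp⟩).mono
        (by intro x hx; simp only [Set.mem_insert_iff, Set.mem_singleton_iff, Set.mem_union] at *
            tauto) subset_rfl
  obtain ⟨c, d, hcd, hc, hd⟩ : T'.Separates (T.side a b) (T.side b a) :=
    Separates.of_pairs (side_nonempty hab) (side_nonempty hab.symm) fun i hi i' hi' =>
      (Separates.of_pairs (side_nonempty hab.symm) ⟨i, by simp⟩
        fun l hl l' hl' => h2 i hi i' hi' l hl l' hl').symm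
  refine ⟨c, d, hcd, hc.antisymm' fun i hi => ?_⟩
  by_contra hi'
  exact (mem_side_swap hcd).1 (hd ((mem_side_swap hab).2 hi')) hi

lemma exists_side_eq (hn : 3 ≤ n) (hT : T.IsEssential) (hnz : T.IsInternalNonzero)
    (hstar : T.IsPseudostar k) (hab : T.graph.Adj a b) :
    ∃ c d, T'.graph.Adj c d ∧ T'.side c d = T.side a b := by
  have hflip : (∃ c d, T'.graph.Adj c d ∧ T'.side c d = T.side b a) →
      ∃ c d, T'.graph.Adj c d ∧ T'.side c d = T.side a b := by
    rintro ⟨c, d, hcd, h⟩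
    exact ⟨d, c, hcd.symm, by rw [side_swap hcd, h, side_swap hab, compl_compl]⟩
  have hpend : ∀ {a b}, T.graph.Adj a b → T.IsLeaf a →
      ∃ c d, T'.graph.Adj c d ∧ T'.side c d = T.side a b := by
    intro a b hab ha
    obtain ⟨i, -, -, hi⟩ := side_eq_of_isLeaf hab ha
    exact ⟨_, _, T'.adj_nbr i, by rw [side_leaf_nbr, hi]⟩
  by_cases ha : T.IsLeaf a
  · exact hpend hab ha
  by_cases hb : T.IsLeaf b
  · exact hflip (hpend hab.symm hb)
  have h0 : T.weight s(a, b) ≠ 0 := hnz _ ((isInternal_iff hT hn).2 ⟨hab, ha, hb⟩)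
  replace ha := (isLeaf_or_isNode hT hn a).resolve_left ha
  replace hb := (isLeaf_or_isNode hT hn b).resolve_left hb
  rcases hstar a b hab with h | h
  · exact hflip (exists_side_eq_of_le hk hmw hab.symm hb ha (by rwa [Sym2.eq_swap]) h)
  · exact exists_side_eq_of_le hk hmw hab ha hb h0 h

end Transfer

end LeafTree

/-! ### Trees with the same splits are isomorphic -/

namespace LeafTree

open SimpleGraph WeightedTree

variable {n k : ℕ} {T T' : LeafTree n}

/-- Every side of an edge of `T` is a side of an edge of `T'`. -/
def SidesSubset (T T' : LeafTree n) : Prop :=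
  ∀ a b, T.graph.Adj a b → ∃ c d, T'.graph.Adj c d ∧ T'.side c d = T.side a b

/-- The vertices `v` of `T` and `v'` of `T'` lie on the same side of every split of `[n]` that
comes from both trees. -/
def Corresponds (T T' : LeafTree n) (v : T.V) (v' : T'.V) : Prop :=
  ∀ a b c d, T.graph.Adj a b → T'.graph.Adj c d → T.side a b = T'.side c d →
    (v ∈ T.graph.edgeComp a b ↔ v' ∈ T'.graph.edgeComp c d)

lemma corresponds_leaf (i : Fin n) : Corresponds T T' (T.leaf i) (T'.leaf i) := by
  intro a b c d _ _ h
  rw [← mem_side, ← mem_side, h]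

namespace Corresponds

lemma symm {v : T.V} {v' : T'.V} (h : Corresponds T T' v v') : Corresponds T' T v' v :=
  fun a b c d hab hcd he => (h c d a b hcd hab he.symm).symm

lemma unique (hs : T'.SidesSubset T) {v : T.V} {u' v' : T'.V} (h : Corresponds T T' v u')
    (h' : Corresponds T T' v v') : u' = v' := by
  by_contra hne
  obtain ⟨c, d, hcd, hu, hv⟩ := T'.isTree.exists_edgeComp_of_ne hne
  obtain ⟨a, b, hab, he⟩ := hs c d hcd
  rw [T'.isTree.mem_edgeComp_swap hcd, ← h' a b c d hab hcd he, h a b c d hab hcd he] at hv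
  exact hv hu

/-- The splits on whose sides `v` lies orient the edges of `T'` consistently, and a vertex of `T'`
with the largest number of edges oriented towards it has all edges oriented towards it. -/
lemma exists_right (hn : 3 ≤ n) (hT : T.IsEssential) (hs : T'.SidesSubset T) (v : T.V) :
    ∃ v', Corresponds T T' v v' := by
  let chosen : T'.V → T'.V → Prop := fun c d => T'.graph.Adj c d ∧
    ∃ a b, T.graph.Adj a b ∧ T.side a b = T'.side c d ∧ v ∈ T.graph.edgeComp a b
  have hor : ∀ c d, T'.graph.Adj c d → chosen c d ∨ chosen d c := by
    intro c d hcd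
    obtain ⟨a, b, hab, he⟩ := hs c d hcd
    by_cases hv : v ∈ T.graph.edgeComp a b
    · exact Or.inl ⟨hcd, a, b, hab, he, hv⟩
    · exact Or.inr ⟨hcd.symm, b, a, hab.symm, by rw [side_swap hab, he, side_swap hcd],
        (T.isTree.mem_edgeComp_swap hab).2 hv⟩
  have hinter : ∀ {c d p q}, chosen c d → chosen p q → ∃ i, i ∈ T'.side c d ∧ i ∈ T'.side p q := by
    rintro c d p q ⟨-, a, b, hab, he, hv⟩ ⟨-, a', b', hab', he', hv'⟩
    rw [← he, ← he']
    exact exists_mem_side_inter hT hn hab hab' hv hv'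
  obtain ⟨v', -, hmax⟩ := Set.exists_max_image Set.univ
    (fun v' => {e : T'.V × T'.V | chosen e.1 e.2 ∧ v' ∈ T'.graph.edgeComp e.1 e.2}.ncard)
    (Set.toFinite _) ⟨T'.leaf ⟨0, by omega⟩, trivial⟩
  -- Moving from `v'` to `x` changes the side of the edge between them only.
  have hnb : ∀ x, T'.graph.Adj x v' → chosen v' x := by
    intro x hx
    by_contra hcon
    have hxv := (hor _ _ hx).resolve_right hcon
    refine (hmax x trivial).not_gt (Set.ncard_lt_ncard ⟨?_, fun hsub => ?_⟩ (Set.toFinite _))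
    · rintro ⟨c, d⟩ ⟨hcd, hv'⟩
      refine ⟨hcd, (mem_edgeComp_congr hx fun he => ?_).2 hv'⟩
      rcases Sym2.eq_iff.1 he with ⟨rfl, rfl⟩ | ⟨rfl, rfl⟩
      · exact T'.isTree.right_notMem_edgeComp hx hv'
      · exact hcon hcd
    · have := hsub (show (x, v') ∈ {e : T'.V × T'.V | chosen e.1 e.2 ∧
        x ∈ T'.graph.edgeComp e.1 e.2} from ⟨hxv, left_mem_edgeComp _ _ _⟩)
      exact T'.isTree.right_notMem_edgeComp hx this.2
  have hall : ∀ c d, chosen c d → v' ∈ T'.graph.edgeComp c d := by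
    intro c d hcd
    by_contra hv'
    have hc : c ≠ v' := fun h => hv' (h ▸ left_mem_edgeComp _ _ _)
    obtain ⟨x, hx, hcx⟩ := T'.isTree.exists_branch hc
    obtain ⟨i, hi, hi'⟩ := hinter hcd (hnb x hx)
    exact (mem_side_swap hx).1 hi' (edgeComp_subset_of_mem hcx hv' hi)
  refine ⟨v', fun a b c d hab hcd he => ⟨fun hv => hall c d ⟨hcd, a, b, hab, he, hv⟩, ?_⟩⟩
  intro hv'
  by_contra hv
  refine (T'.isTree.mem_edgeComp_swap hcd).1 (hall d c ⟨hcd.symm, b, a, hab.symm, ?_, ?_⟩) hv'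
  · rw [side_swap hab, he, side_swap hcd]
  · exact (T.isTree.mem_edgeComp_swap hab).2 hv

lemma adj_and_side_eq (hn : 3 ≤ n) (hT' : T'.IsEssential) (hs : T.SidesSubset T')
    (hs' : T'.SidesSubset T) {u v : T.V} {u' v' : T'.V} (hu : Corresponds T T' u u')
    (hv : Corresponds T T' v v') (huv : T.graph.Adj u v) :
    T'.graph.Adj u' v' ∧ T'.side u' v' = T.side u v := by
  -- The vertex corresponding to an end of an edge is the end of the edge with the same split.
  have key : ∀ {u v : T.V} {u' v' c d : T'.V}, Corresponds T T' u u' → Corresponds T T' v v' →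
      T.graph.Adj u v → T'.graph.Adj c d → T'.side c d = T.side u v → u' = c := by
    intro u v u' v' c d hu hv huv hcd he
    have he' : T.side v u = T'.side d c := by rw [side_swap huv, ← he, side_swap hcd]
    have hu' : u' ∈ T'.graph.edgeComp c d :=
      (hu u v c d huv hcd he.symm).1 (left_mem_edgeComp _ _ _)
    have hv' : v' ∈ T'.graph.edgeComp d c :=
      (hv v u d c huv.symm hcd.symm he').1 (left_mem_edgeComp _ _ _)
    by_contra hne
    obtain ⟨p, q, hpq, hup, hcq⟩ := T'.isTree.exists_edgeComp_of_ne hne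
    have hpq_ne : s(p, q) ≠ s(c, d) := by
      intro h
      rcases Sym2.eq_iff.1 h with ⟨rfl, rfl⟩ | ⟨rfl, rfl⟩
      · exact T'.isTree.right_notMem_edgeComp hpq.symm hcq
      · exact (T'.isTree.mem_edgeComp_swap hcd).1 hup hu'
    obtain ⟨r, s, hrs, hrse⟩ := hs' p q hpq
    have hvr : v ∈ T.graph.edgeComp r s := by
      refine (mem_edgeComp_congr huv fun h => hpq_ne ?_).1 ((hu r s p q hrs hpq hrse).2 hup)
      rcases Sym2.eq_iff.1 h with ⟨rfl, rfl⟩ | ⟨rfl, rfl⟩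
      · obtain ⟨rfl, rfl⟩ := eq_of_side_eq hT' hn hpq hcd (hrse.symm.trans he.symm)
        rfl
      · obtain ⟨rfl, rfl⟩ := eq_of_side_eq hT' hn hpq hcd.symm (hrse.symm.trans he')
        exact Sym2.eq_swap
    have hvp := (hv r s p q hrs hpq hrse).1 hvr
    have hdq := (mem_edgeComp_congr hcd
      (by rw [Sym2.eq_swap (a := q)]; exact hpq_ne.symm)).1 hcq
    have hnot := fun {x} => T'.isTree.mem_edgeComp_swap hpq (v := x)
    rcases T'.isTree.edgeComp_compat hpq hcd with h | h | h | h
    · exact hnot.1 hcq (h (left_mem_edgeComp _ _ _))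
    · exact hnot.1 hdq (h (left_mem_edgeComp _ _ _))
    · exact hnot.1 (h hu') hup
    · exact hnot.1 (h hv') hvp
  obtain ⟨c, d, hcd, he⟩ := hs u v huv
  obtain rfl := key hu hv huv hcd he
  obtain rfl := key hv hu huv.symm hcd.symm (by rw [side_swap hcd, he, side_swap huv])
  exact ⟨hcd, he⟩

end Corresponds

/-- An essential tree is determined by its splits. -/
lemma exists_graphIso (hn : 3 ≤ n) (hT : T.IsEssential) (hT' : T'.IsEssential)
    (hs : T.SidesSubset T') (hs' : T'.SidesSubset T) :
    ∃ φ : T.graph ≃g T'.graph, (∀ v, Corresponds T T' v (φ v)) ∧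
      (∀ i, φ (T.leaf i) = T'.leaf i) ∧
      ∀ u v, T.graph.Adj u v → T'.side (φ u) (φ v) = T.side u v := by
  choose f hf using Corresponds.exists_right hn hT hs'
  choose g hg using Corresponds.exists_right hn hT' hs
  have hadj : ∀ {u v}, T.graph.Adj u v → T'.graph.Adj (f u) (f v) ∧
      T'.side (f u) (f v) = T.side u v := fun {u v} huv =>
    Corresponds.adj_and_side_eq hn hT' hs hs' (hf u) (hf v) huv
  have hgf : Function.LeftInverse g f := fun v =>
    Corresponds.unique hs (hg (f v)) (hf v).symm
  refine ⟨⟨⟨f, g, hgf, fun v => Corresponds.unique hs' (hf (g v)) (hg v).symm⟩, ?_⟩, hf, ?_, ?_⟩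
  · intro u v
    refine ⟨fun h => ?_, fun h => (hadj h).1⟩
    exact (Corresponds.adj_and_side_eq hn hT hs' hs (hf u).symm (hf v).symm h).1
  · exact fun i => Corresponds.unique hs' (hf _) (corresponds_leaf i)
  · exact fun u v huv => (hadj huv).2

/-! ### Multiweights determine the weights -/

lemma Spans.of_corresponds (hs' : T'.SidesSubset T) {a : T.V} {a' : T'.V}
    (ha : Corresponds T T' a a') {i j : Fin n} (h : T.Spans a i j) : T'.Spans a' i j := by
  intro c d hcd hi hj
  obtain ⟨p, q, hpq, he⟩ := hs' c d hcd
  rw [← he] at hi hj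
  exact (ha p q c d hpq hcd he).1 (h p q hpq hi hj)

/-- The quartet formula computes the weights of corresponding internal edges from the same
`k`-weights. -/
lemma weight_eq_of_le (hk : 3 ≤ k) (hmw : ∀ I : Finset (Fin n), I.card = k →
      T.multiweight (T.leaf '' (I : Set (Fin n))) = T'.multiweight (T'.leaf '' (I : Set (Fin n))))
    (hs' : T'.SidesSubset T) {a b : T.V} {a' b' : T'.V}
    (ha' : Corresponds T T' a a') (hb' : Corresponds T T' b b') (hab : T.graph.Adj a b)
    (hab' : T'.graph.Adj a' b') (he : T'.side a' b' = T.side a b) (ha : T.IsNode a)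
    (hb : T.IsNode b) (hside : k ≤ (T.side b a).ncard) :
    T'.weight s(a', b') = T.weight s(a, b) := by
  have hnl : ∀ {v}, T.IsNode v → ¬ T.IsLeaf v := by
    intro v h1 h2
    unfold IsNode at h1
    unfold IsLeaf at h2
    omega
  obtain ⟨i, hi, j, hj, hij⟩ := exists_spans_pair hab ha
  obtain ⟨l, hl, m, hm, hlm⟩ := exists_spans_pair hab.symm hb
  obtain ⟨R, hR, hRb, hlR, hmR⟩ := exists_subset_side hside l m
  have hR0 : R.Nonempty := Finset.card_pos.1 (by omega)
  have he' : T'.side b' a' = T.side b a := by rw [side_swap hab', he, side_swap hab]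
  have hnot : ∀ {x y : Fin n}, x ∈ T.side a b → y ∈ T.side b a → x ≠ y := by
    rintro x y hx hy rfl
    exact (mem_side_swap hab).1 hy hx
  have hnR : ∀ {x : Fin n}, x ∈ T.side a b → x ∉ R := fun hx hxR => hnot hx (hRb _ hxR) rfl
  have hk2 : 2 ≤ k := by omega
  rw [← pairSum_sub_pairSum hab hij hlm hi hj hl hm hR0 hRb,
    ← pairSum_sub_pairSum hab' (hij.of_corresponds hs' ha') (hlm.of_corresponds hs' hb')
      (he ▸ hi) (he ▸ hj) (he' ▸ hl) (he' ▸ hm) hR0 (he' ▸ hRb),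
    pairSum_congr hk2 hmw hR (hnot hi hl) (hnot hj hm) (hnR hi) hlR (hnR hj) hmR,
    pairSum_congr hk2 hmw hR (hij.ne (hnl ha)) (hlm.ne (hnl hb)) (hnR hi) (hnR hj) hlR hmR]

/-- A function on `[n]` whose sums over all `k`-subsets vanish is zero, if `0 < k < n`. -/
lemma eq_zero_of_sum_eq_zero (hk : 0 < k) (hkn : k < n) {u : Fin n → ℝ}
    (h : ∀ I : Finset (Fin n), I.card = k → ∑ i ∈ I, u i = 0) (i : Fin n) : u i = 0 := by
  have hconst : ∀ i j, u i = u j := by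
    intro i j
    by_cases hij : i = j
    · rw [hij]
    have hcard : k - 1 ≤ ((Finset.univ.erase i).erase j).card := by
      rw [Finset.card_erase_of_mem (by simp [Ne.symm hij]),
        Finset.card_erase_of_mem (Finset.mem_univ _), Finset.card_univ, Fintype.card_fin]
      omega
    obtain ⟨R, hR, hRk⟩ := Finset.exists_subset_card_eq hcard
    have hiR : i ∉ R := fun hi =>
      absurd rfl (Finset.ne_of_mem_erase (Finset.mem_of_mem_erase (hR hi)))
    have hjR : j ∉ R := fun hj => absurd rfl (Finset.ne_of_mem_erase (hR hj))
    have h1 := h (insert i R) (by rw [Finset.card_insert_of_notMem hiR]; omega)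
    have h2 := h (insert j R) (by rw [Finset.card_insert_of_notMem hjR]; omega)
    rw [Finset.sum_insert hiR] at h1
    rw [Finset.sum_insert hjR] at h2
    linarith
  obtain ⟨I, -, hI⟩ := Finset.exists_subset_card_eq
    (show k ≤ (Finset.univ : Finset (Fin n)).card by simpa using hkn.le)
  have h1 := h I hI
  rw [Finset.sum_congr rfl fun j _ => hconst j i, Finset.sum_const, hI, nsmul_eq_mul] at h1
  exact (mul_eq_zero.1 h1).resolve_left (by positivity)

open Classical in
lemma multiweight_eq_sum_map (φ : T.graph ≃g T'.graph)
    (hside : ∀ u v, T.graph.Adj u v → T'.side (φ u) (φ v) = T.side u v) (I : Finset (Fin n)) :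
    T'.multiweight (T'.leaf '' (I : Set (Fin n))) =
      ∑ e : Sym2 T.V with e ∈ (T.minimalSubtree (T.leaf '' (I : Set (Fin n)))).edgeSet,
        T'.weight (e.map φ) := by
  have hmem : ∀ u v, s(φ u, φ v) ∈ (T'.minimalSubtree (T'.leaf '' (I : Set (Fin n)))).edgeSet ↔
      s(u, v) ∈ (T.minimalSubtree (T.leaf '' (I : Set (Fin n)))).edgeSet := by
    intro u v
    by_cases huv : T.graph.Adj u v
    · rw [mem_edgeSet_minimalSubtree huv, mem_edgeSet_minimalSubtree (φ.map_adj_iff.2 huv),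
        hside u v huv]
    · exact ⟨fun h => absurd (φ.map_adj_iff.1 (T'.edgeSet_minimalSubtree_subset h)) huv,
        fun h => absurd (T.edgeSet_minimalSubtree_subset h) huv⟩
  rw [multiweight]
  symm
  refine Finset.sum_bij (fun e _ => e.map φ) ?_ ?_ ?_ fun _ _ => rfl
  · rintro ⟨u, v⟩ he
    simp only [Finset.mem_filter, Finset.mem_univ, true_and] at he ⊢
    exact (hmem u v).2 he
  · intro e _ e' _ h
    exact Sym2.map.injective φ.injective h
  · rintro ⟨x, y⟩ he
    obtain ⟨u, rfl⟩ := φ.surjective x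
    obtain ⟨v, rfl⟩ := φ.surjective y
    simp only [Finset.mem_filter, Finset.mem_univ, true_and] at he
    refine ⟨s(u, v), ?_, rfl⟩
    simp only [Finset.mem_filter, Finset.mem_univ, true_and]
    exact (hmem u v).1 he

/-- The `k`-weights determine an internal-nonzero-weighted essential pseudostar. -/
lemma IsRealizingPseudostar.iso (hk : 3 ≤ k) (hkn : k < n) {D : KSubset n k → ℝ}
    (hT : T.IsRealizingPseudostar D) (hT' : T'.IsRealizingPseudostar D) : Iso T T' := by
  classical
  have hn : 3 ≤ n := by omega
  have hmw : ∀ I : Finset (Fin n), I.card = k → T.multiweight (T.leaf '' (I : Set (Fin n))) =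
      T'.multiweight (T'.leaf '' (I : Set (Fin n))) := fun I hI =>
    (hT.realizes ⟨I, hI⟩).trans (hT'.realizes ⟨I, hI⟩).symm
  have hs : T.SidesSubset T' := fun a b hab =>
    exists_side_eq hk hmw hn hT.essential hT.internalNonzero hT.pseudostar hab
  have hs' : T'.SidesSubset T := fun a b hab =>
    exists_side_eq hk (fun I hI => (hmw I hI).symm) hn hT'.essential hT'.internalNonzero
      hT'.pseudostar hab
  obtain ⟨φ, hφ, hleaf, hside⟩ := exists_graphIso hn hT.essential hT'.essential hs hs'
  have hnode : ∀ u v, T.graph.Adj u v → ¬ T.IsLeaf u → ¬ T.IsLeaf v →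
      T'.weight s(φ u, φ v) = T.weight s(u, v) := by
    intro u v huv hu hv
    replace hu := (isLeaf_or_isNode hT.essential hn u).resolve_left hu
    replace hv := (isLeaf_or_isNode hT.essential hn v).resolve_left hv
    rcases hT.pseudostar u v huv with h | h
    · rw [Sym2.eq_swap, weight_eq_of_le hk hmw hs' (hφ v) (hφ u) huv.symm
        (φ.map_adj_iff.2 huv.symm) (hside v u huv.symm) hv hu h, Sym2.eq_swap]
    · exact weight_eq_of_le hk hmw hs' (hφ u) (hφ v) huv (φ.map_adj_iff.2 huv) (hside u v huv)
        hu hv h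
  have hpend : ∀ i, T'.weight ((T.pend i).map φ) - T.weight (T.pend i) = 0 := by
    refine eq_zero_of_sum_eq_zero (by omega) hkn fun I hI => ?_
    have h1 := hmw I hI
    rw [multiweight_eq_sum_map φ hside, multiweight, ← sub_eq_zero, ← neg_eq_zero, neg_sub,
      ← Finset.sum_sub_distrib] at h1
    rw [← h1, ← Finset.sum_image (f := fun e : Sym2 T.V => T'.weight (e.map φ) - T.weight e)
      (pend_injective hn).injOn]
    refine Finset.sum_subset (fun e he => ?_) fun e he hne => ?_
    · obtain ⟨i, hi, rfl⟩ := Finset.mem_image.1 he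
      simp only [Finset.mem_filter, Finset.mem_univ, true_and]
      exact (pend_mem_edgeSet_minimalSubtree (by omega) i).2 hi
    · simp only [Finset.mem_filter, Finset.mem_univ, true_and] at he
      have hleaf_mem : ∀ i, T.pend i = e → False := by
        rintro i rfl
        exact hne (Finset.mem_image.2
          ⟨i, (pend_mem_edgeSet_minimalSubtree (by omega) i).1 he, rfl⟩)
      obtain ⟨u, v⟩ := e
      have huv : T.graph.Adj u v := T.edgeSet_minimalSubtree_subset he
      refine sub_eq_zero.2 (hnode u v huv (fun hu => ?_) fun hv => ?_)
      · obtain ⟨i, rfl, rfl, -⟩ := side_eq_of_isLeaf huv hu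
        exact hleaf_mem i rfl
      · obtain ⟨i, rfl, rfl, -⟩ := side_eq_of_isLeaf huv.symm hv
        exact hleaf_mem i Sym2.eq_swap
  refine ⟨φ, hleaf, fun u v huv => ?_⟩
  by_cases hu : T.IsLeaf u
  · obtain ⟨i, rfl, rfl, -⟩ := side_eq_of_isLeaf huv hu
    exact sub_eq_zero.1 (hpend i)
  by_cases hv : T.IsLeaf v
  · obtain ⟨i, rfl, rfl, -⟩ := side_eq_of_isLeaf huv.symm hv
    rw [Sym2.eq_swap, Sym2.eq_swap (a := T.nbr i)]
    exact sub_eq_zero.1 (hpend i)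
  exact hnode u v huv hu hv

/-! ### Isomorphic trees admit the same operations -/

namespace Iso

lemma isPositive (h : Iso T T') (hpos : T'.IsPositive) : T.IsPositive := by
  obtain ⟨φ, -, hw⟩ := h
  rintro ⟨u, v⟩ huv
  exact (hw u v huv).symm ▸ hpos _ (φ.map_adj_iff.2 huv)

/-- A contraction onto a tree is also one onto every isomorphic tree. -/
lemma isContraction {Q P : LeafTree n} (h : Iso P Q) {a b : T.V} {φ : T.V → Q.V}
    (hφ : IsContraction T.toWeightedTree Q.toWeightedTree a b φ)
    (hleaf : ∀ i, φ (T.leaf i) = Q.leaf i) :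
    ∃ ψ : T.V → P.V, IsContraction T.toWeightedTree P.toWeightedTree a b ψ ∧
      (∀ i, ψ (T.leaf i) = P.leaf i) ∧ ∀ u v, T.graph.Adj u v → s(u, v) ≠ s(a, b) →
        P.weight s(ψ u, ψ v) = Q.weight s(φ u, φ v) := by
  obtain ⟨θ, hθ, hw⟩ := h
  have hcon : IsContraction T.toWeightedTree P.toWeightedTree a b (θ.symm ∘ φ) := by
    refine ⟨hφ.adj, θ.symm.surjective.comp hφ.surjective, fun u v => ?_, fun x y => ?_⟩
    · rw [← hφ.eq_iff]
      exact θ.symm.injective.eq_iff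
    · rw [← θ.map_adj_iff, hφ.adj_iff, θ.injective.ne_iff]
      simp only [Function.comp_apply, RelIso.symm_apply_eq]
  refine ⟨θ.symm ∘ φ, hcon, fun i => ?_, fun u v huv hne => ?_⟩
  · rw [Function.comp_apply, hleaf, ← hθ, RelIso.symm_apply_apply]
  · rw [← hw _ _ (hcon.map_adj huv hne)]
    simp

lemma isOI (hn : 3 ≤ n) {Q P : LeafTree n} (h : Iso P Q) (hP : P.IsEssential) (hQ : Q.IsEssential)
    (hT : IsOI k Q T) : IsOI k P T := by
  obtain ⟨a, b, φ, hφ, hleaf, h1, h2, htw, hw⟩ := hT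
  obtain ⟨ψ, hψ, hleaf', hw'⟩ := h.isContraction hφ hleaf
  refine ⟨a, b, ψ, hψ, hleaf', h1, h2, fun i => ?_, fun u v huv hne => ?_⟩
  · rw [← htw i, twigWeight_eq hP hn, twigWeight_eq hQ hn]
    obtain ⟨θ, hθ, hw⟩ := h
    have hadj := θ.map_adj_iff.2 (P.adj_nbr i)
    have := hw _ _ (P.adj_nbr i)
    rw [hθ] at hadj this
    rw [eq_nbr hadj] at this
    exact this.symm
  · rw [hw' u v huv.1 hne, hw u v huv hne]

lemma isZeroInsertion {Q P : LeafTree n} (h : Iso P Q) (hT : IsZeroInsertion Q T) :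
    IsZeroInsertion P T := by
  obtain ⟨a, b, φ, hφ, hleaf, hint, h0, hw⟩ := hT
  obtain ⟨ψ, hψ, hleaf', hw'⟩ := h.isContraction hφ hleaf
  exact ⟨a, b, ψ, hψ, hleaf', hint, h0, fun u v huv hne => by rw [hw' u v huv hne, hw u v huv hne]⟩

end Iso

end LeafTree

lemma Relation.ReflTransGen.of_forall_head {α : Type*} {r : α → α → Prop} {p q t : α}
    (h : Relation.ReflTransGen r q t) (hqt : q ≠ t) (hr : ∀ x, r q x → r p x) :
    Relation.ReflTransGen r p t := by
  rcases h.cases_head with rfl | ⟨x, hqx, hxt⟩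
  · exact absurd rfl hqt
  · exact hxt.head (hr x hqx)

theorem theorem3p4 (n k : ℕ) (hk : 3 ≤ k) (hkn : k < n) (D : KSubset n k → ℝ)
    (hD : IsLTreelike D) :
    ∃ P : LeafTree n, P.IsRealizingPseudostar D ∧
      (∀ Q : LeafTree n, Q.IsRealizingPseudostar D → LeafTree.Iso P Q) ∧
      (∀ T : LeafTree n, T.IsEssential → T.Realizes D → ¬ LeafTree.Iso P T →
        Relation.ReflTransGen
          (fun A B : LeafTree n => LeafTree.IsOI k A B ∨ LeafTree.IsZeroInsertion A B) P T) ∧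
      (IsPLTreelike D →
        P.IsPositive ∧
        ∀ T : LeafTree n, T.IsEssential → T.IsPositive → T.Realizes D → ¬ LeafTree.Iso P T →
          Relation.ReflTransGen (fun A B : LeafTree n => LeafTree.IsOI k A B) P T) := by
  have hn : 3 ≤ n := by omega
  obtain ⟨T₀, f, hf, hleaf, hfD⟩ := hD
  obtain ⟨L, hL, hLD, -⟩ := T₀.exists_leafTree hn f hf hleaf
  obtain ⟨P, hP, -⟩ := LeafTree.exists_isRealizingPseudostar hk hkn L hL
    fun I => (hLD I.1).trans (hfD I)
  have huniq : ∀ Q : LeafTree n, Q.IsRealizingPseudostar D → LeafTree.Iso P Q := fun Q hQ =>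
    hP.iso hk hkn hQ
  refine ⟨P, hP, huniq, fun T hT hTD hne => ?_, ?_⟩
  · obtain ⟨Q, hQ, hr, -⟩ := LeafTree.exists_isRealizingPseudostar hk hkn T hT hTD
    refine hr.of_forall_head (fun h => hne (h ▸ huniq Q hQ)) fun x hx => ?_
    exact hx.imp ((huniq Q hQ).isOI hn hP.essential hQ.essential) (huniq Q hQ).isZeroInsertion
  · rintro ⟨T₁, hpos, f₁, hf₁, hleaf₁, hfD₁⟩
    obtain ⟨L₁, hL₁, hLD₁, hLpos⟩ := T₁.exists_leafTree hn f₁ hf₁ hleaf₁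
    obtain ⟨Q₁, hQ₁, -, hQpos⟩ := LeafTree.exists_isRealizingPseudostar hk hkn L₁ hL₁
      fun I => (hLD₁ I.1).trans (hfD₁ I)
    refine ⟨(huniq Q₁ hQ₁).isPositive (hQpos (hLpos hpos)).1, fun T hT hTpos hTD hne => ?_⟩
    obtain ⟨Q, hQ, -, hr⟩ := LeafTree.exists_isRealizingPseudostar hk hkn T hT hTD
    refine (hr hTpos).2.of_forall_head (fun h => hne (h ▸ huniq Q hQ)) fun x hx => ?_
    exact (huniq Q hQ).isOI hn hP.essential hQ.essential hx
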